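/- Let $C$ be a copula on $\mathbb R^d$ (a distribution function on $\mathbb R^d$ whose univariate margins are uniform on $[0,1]$). Let $\|\cdot\|_D$ be a $D$-norm on $\mathbb R^d$, i.e. a norm of the form $\|x\|_D=E\bigl(\max_{1\le i\le d}|x_i|Z_i\bigr)$ for a random vector $Z=(Z_1,\dots,Z_d)$ with $Z_i\ge 0$ and $E(Z_i)=1$ for all $i$. Suppose that $$C(u)=1-\|\mathbf 1-u\|_D+o(\|\mathbf 1-u\|)\qquad\text{as } u\to\mathbf 1=(1,\dots,1),\ \text{uniformly for } u\in[0,1]^d .$$ Let $X^{(1)},X^{(2)},\dots$ be independent random vectors in $\mathbb R^d$, each with distribution function $C$, and for $1\le m\le n$ let $X_{m:n,i}$ denote the $m$-th smallest of the $i$-th components $X^{(1)}_i,\dots,X^{(n)}_i$, $1\le i\le d$. Let $k=k(n)\in\{1,\dots,n-1\}$, $n\ge 2$, satisfy $k\to\infty$ and $k/n\to 0$ as $n\to\infty$. Suppose that the $d\times d$ matrix $\Lambda=(\lambda_{ij})$ with $$\lambda_{ii}=1,\qquad \lambda_{ij}=\bigl(2-\|e_i+e_j\|_D\bigr)^{1/2}\quad(i\ne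 j),$$ where $e_i$ is the $i$-th unit vector of $\mathbb R^d$, is positive semidefinite, and let $\xi^{(1)},\xi^{(2)},\dots$ be independent random vectors with the normal distribution $N(\mathbf 0,\Lambda)$ on $\mathbb R^d$. Then $$\sup_{x\in\mathbb R^d}\left|P\Bigl(\bigl(X_{n-k:n,i}\bigr)_{i=1}^d\le x\Bigr)-P\left(\left(\frac{\sum_{j=1}^{2(n-k)}\bigl(\xi_i^{(j)}\bigr)^2}{\sum_{j=1}^{2(n+1)}\bigl(\xi_i^{(j)}\bigr)^2}\right)_{i=1}^d\le x\right)\right|\longrightarrow 0\qquad(n\to\infty),$$ where inequalities between vectors are meant componentwise. -/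

import Mathlib

open MeasureTheory ProbabilityTheory Filter Topology Asymptotics

/-- The random vector `X` on `(Ω, P)` has the distribution function `F`, where inequalities between
vectors are componentwise. -/
def HasDistributionFunction {d : ℕ} {Ω : Type*} [MeasurableSpace Ω] (P : Measure Ω)
    (X : Ω → Fin d → ℝ) (F : (Fin d → ℝ) → ℝ) : Prop :=
  AEMeasurable X P ∧ ∀ x, P.real {ω | X ω ≤ x} = F x

/-- A copula on `ℝ^d`: the distribution function of a probability measure on `ℝ^d` all of whose
one-dimensional margins are the uniform distribution on `[0, 1]`. -/
def IsCopula {d : ℕ} (C : (Fin d → ℝ) → ℝ) : Prop :=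
  ∃ μ : Measure (Fin d → ℝ), IsProbabilityMeasure μ ∧
    (∀ i, μ.map (fun x => x i) = volume.restrict (Set.Icc (0 : ℝ) 1)) ∧
    ∀ x, C x = μ.real (Set.Iic x)

/-- A `D`-norm on `ℝ^d`: there is a random vector `Z` (a generator, given through its law `ν`) with
`Z_i ≥ 0`, `E Z_i = 1` and `‖x‖_D = E (max_i |x_i| Z_i)`.  A function of this form is
automatically a norm, and `E Z_i = 1` forces `Z_i` to be integrable. -/
def IsDNorm {d : ℕ} (N : (Fin d → ℝ) → ℝ) : Prop :=
  ∃ ν : Measure (Fin d → ℝ), IsProbabilityMeasure ν ∧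
    (∀ᵐ z ∂ν, ∀ i, 0 ≤ z i) ∧
    (∀ i, ∫ z, z i ∂ν = 1) ∧
    ∀ x, N x = ∫ z, (⨆ i, |x i| * z i) ∂ν

/-- The expansion `C(u) = 1 - ‖1 - u‖_D + o(‖1 - u‖)` as `u → 1`, uniformly for `u ∈ [0,1]^d`. -/
def HasDNormExpansion {d : ℕ} (C N : (Fin d → ℝ) → ℝ) : Prop :=
  (fun u => C u - (1 - N (1 - u))) =o[𝓝[Set.Icc 0 1] (1 : Fin d → ℝ)] fun u => ‖1 - u‖

/-- The `m`-th smallest value `y_{m:n}` of the sample `y_1, …, y_n`, for `1 ≤ m ≤ n`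
(and `0` for other `m`). -/
noncomputable def orderStat {n : ℕ} (y : Fin n → ℝ) (m : ℕ) : ℝ :=
  if h : 1 ≤ m ∧ m ≤ n then y (Tuple.sort y ⟨m - 1, by omega⟩) else 0

/-- The vector `(X_{m:n,i})_i` of componentwise order statistics of the first `n` members of the
sequence `X` of vectors. -/
noncomputable def componentwiseOrderStat {d : ℕ} (X : ℕ → Fin d → ℝ) (n m : ℕ) : Fin d → ℝ :=
  fun i => orderStat (fun j : Fin n => X j i) m

/-- The matrix with diagonal entries `1` and off-diagonal entries `(2 - ‖e_i + e_j‖_D)^{1/2}`. -/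
noncomputable def sqrtCovMatrix {d : ℕ} (N : (Fin d → ℝ) → ℝ) : Matrix (Fin d) (Fin d) ℝ :=
  Matrix.of fun i j =>
    if i = j then 1 else Real.sqrt (2 - N (Pi.single i 1 + Pi.single j 1))

/-- The vector of ratios of the sum of the first `p` squares to the sum of the first `q` squares,
taken in each component. -/
noncomputable def squareSumRatio {d : ℕ} (ξ : ℕ → EuclideanSpace ℝ (Fin d)) (p q : ℕ) :
    Fin d → ℝ :=
  fun i => (∑ j ∈ Finset.range p, (ξ j i) ^ 2) / ∑ j ∈ Finset.range q, (ξ j i) ^ 2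

/-! ### Characteristic functions of row-wise independent arrays -/

/-! Both random vectors, after the same increasing map `z ↦ (n (z - 1) + k) / √k` in each component,
are asymptotically normal with the same limit: mean zero and covariance `λ_{il}²`, the Hadamard
square of `Λ`, which is positive semidefinite by the Schur product theorem.

Order statistics: the event that the normalised value is at most `y_i` says that at most `k`
observations exceed `1 - q_i`, where `q_i = (k - √k y_i) / n`. Inclusion-exclusion and the `D`-norm
expansion give joint exceedance probabilities asymptotic to `(k/n) λ_{il}²`, so Lyapunov's theorem
applies to the centred counts divided by `√k` (`tendsto_joint_exceedance`,
`tendsto_charFun_exceedances`).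

Ratios: the inequality `ratio ≤ 1 - q_i` is linear in the squares. The first `2(n-k)` squares have
weight `q_i` and are negligible; the last `2(k+1)` have weight `q_i - 1`. Squares of standard
normals with correlation `λ` have covariance `2λ²`, which is why `Λ` contains square roots
(`integral_centredSquare_mul`, `tendsto_charFun_ratio`).

The limit has atomless margins, so Pólya's theorem makes both convergences uniform
(`tendstoUniformly_distribution`). A supremum over all thresholds does not see the common
normalisation, so the triangle inequality finishes the proof. -/

lemma norm_exp_mul_I_sub_quadratic_le (x : ℝ) :
    ‖Complex.exp (x * Complex.I) - (1 + x * Complex.I - x ^ 2 / 2)‖ ≤ 4 * |x| ^ 3 := by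
  rcases le_or_gt |x| 1 with h | h
  · have hx : ‖(x : ℂ) * Complex.I‖ = |x| := by simp
    have := Complex.exp_bound (x := x * Complex.I) (by rw [hx]; exact h) (n := 3) (by norm_num)
    rw [hx] at this
    have e : ∑ m ∈ Finset.range 3, ((x : ℂ) * Complex.I) ^ m / (m.factorial : ℂ) =
        1 + x * Complex.I - x ^ 2 / 2 := by
      simp [Finset.sum_range_succ, Nat.factorial, mul_pow]
      ring
    rw [e] at this
    refine this.trans ?_
    rw [mul_comm]
    gcongr
    norm_num [Nat.factorial]
  -- For `|x| > 1` lower powers are dominated by `|x|³`, and `1 + (1 + |x| + x²/2) ≤ 3.5 |x|³`.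
  · have h1 : ‖Complex.exp (x * Complex.I)‖ = 1 := Complex.norm_exp_ofReal_mul_I x
    have h2 : ‖(1 + x * Complex.I - x ^ 2 / 2 : ℂ)‖ ≤ 1 + |x| + |x| ^ 2 / 2 := by
      refine (norm_sub_le _ _).trans (add_le_add ((norm_add_le _ _).trans ?_) ?_)
      · simp
      · simp
    refine (norm_sub_le _ _).trans ?_
    rw [h1]
    have h3 : |x| ≤ |x| ^ 3 := le_self_pow₀ h.le (by norm_num)
    have h4 : |x| ^ 2 ≤ |x| ^ 3 := pow_le_pow_right₀ h.le (by norm_num)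
    linarith

lemma norm_integral_exp_mul_I_sub_le {Ω : Type*} [MeasurableSpace Ω] {P : Measure Ω}
    [IsProbabilityMeasure P] {Y : Ω → ℝ} (hY : MemLp Y 3 P) (h0 : ∫ ω, Y ω ∂P = 0) :
    ‖∫ ω, Complex.exp (Y ω * Complex.I) ∂P - (1 - ((∫ ω, Y ω ^ 2 ∂P : ℝ) : ℂ) / 2)‖ ≤
      4 * ∫ ω, |Y ω| ^ 3 ∂P := by
  have i1 : Integrable Y P := hY.integrable (by norm_num)
  have i2 : Integrable (fun ω => Y ω ^ 2) P :=
    (hY.mono_exponent (by norm_num : (2 : ENNReal) ≤ 3)).integrable_sq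
  have i3 : Integrable (fun ω => |Y ω| ^ 3) P := by
    have h : MemLp Y ((3 : ℕ) : ENNReal) P := by exact_mod_cast hY
    simpa only [Real.norm_eq_abs] using h.integrable_norm_pow three_ne_zero
  have ie : Integrable (fun ω => Complex.exp (Y ω * Complex.I)) P := by
    refine Integrable.of_bound (C := 1) ?_ (ae_of_all _ fun ω => ?_)
    · have := hY.aestronglyMeasurable
      exact Continuous.comp_aestronglyMeasurable
        (g := fun x : ℝ => Complex.exp (x * Complex.I)) (by fun_prop) this
    · rw [Complex.norm_exp_ofReal_mul_I]
  have i1' : Integrable (fun ω => (Y ω : ℂ)) P := i1.ofReal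
  have i2' : Integrable (fun ω => ((Y ω ^ 2 : ℝ) : ℂ)) P := i2.ofReal
  have e : ∫ ω, Complex.exp (Y ω * Complex.I) ∂P - (1 - ((∫ ω, Y ω ^ 2 ∂P : ℝ) : ℂ) / 2) =
      ∫ ω, (Complex.exp (Y ω * Complex.I) -
        (1 + Y ω * Complex.I - ((Y ω ^ 2 : ℝ) : ℂ) / 2)) ∂P := by
    have j1 : Integrable (fun ω => 1 + (Y ω : ℂ) * Complex.I) P :=
      (integrable_const _).add (i1'.mul_const _)
    have j2 : Integrable (fun ω => ((Y ω ^ 2 : ℝ) : ℂ) / 2) P := i2'.div_const _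
    have j3 : Integrable (fun ω => 1 + (Y ω : ℂ) * Complex.I - ((Y ω ^ 2 : ℝ) : ℂ) / 2) P :=
      j1.sub j2
    rw [integral_sub ie j3, integral_sub j1 j2, integral_add (integrable_const _)
      (i1'.mul_const _), integral_mul_const, integral_div,
      integral_complex_ofReal, integral_complex_ofReal, h0]
    simp
  rw [e, ← integral_const_mul]
  refine norm_integral_le_of_norm_le (i3.const_mul 4) (ae_of_all _ fun ω => ?_)
  simpa using norm_exp_mul_I_sub_quadratic_le (Y ω)

/-- The hypothesis forces `z n → 1`, so `z ^ m = exp (m log z)` with `log z = (z - 1) + O((z -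
1)²)`, and `m (z - 1)² → 0`. -/
lemma tendsto_pow_cexp {m : ℕ → ℕ} {z : ℕ → ℂ} {t : ℂ} (hm : Tendsto m atTop atTop)
    (h : Tendsto (fun n => (m n : ℂ) * (z n - 1)) atTop (𝓝 t)) :
    Tendsto (fun n => z n ^ m n) atTop (𝓝 (Complex.exp t)) := by
  have hm' : Tendsto (fun n => ((m n : ℂ))⁻¹) atTop (𝓝 0) := by
    have := (tendsto_inv_atTop_nhds_zero_nat (𝕜 := ℂ)).comp hm
    exact this
  have hg : Tendsto (fun n => z n - 1) atTop (𝓝 0) := by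
    have := hm'.mul h
    rw [zero_mul] at this
    refine this.congr' ?_
    filter_upwards [hm.eventually_ne_atTop 0] with n hn
    have : (m n : ℂ) ≠ 0 := by exact_mod_cast hn
    field_simp
  have hO : (fun n => (m n : ℂ) * (Complex.log (1 + (z n - 1)) - (z n - 1))) =O[atTop]
      fun n => (m n : ℂ) * (z n - 1) ^ 2 :=
    (isBigO_refl _ _).mul (Complex.log_sub_self_isBigO.comp_tendsto hg)
  have h0 : Tendsto (fun n => (m n : ℂ) * (z n - 1) ^ 2) atTop (𝓝 0) := by
    have := h.mul hg
    rw [mul_zero] at this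
    exact this.congr fun n => by ring
  have h1 := (hO.trans_tendsto h0).add h
  rw [zero_add] at h1
  have h2 := (Complex.continuous_exp.tendsto _).comp h1
  refine h2.congr' ?_
  have hz : Tendsto z atTop (𝓝 1) := by simpa using hg.add_const 1
  filter_upwards [hz.eventually_ne one_ne_zero] with n hn
  have e : (m n : ℂ) * (Complex.log (1 + (z n - 1)) - (z n - 1)) + m n * (z n - 1) =
      m n * Complex.log (z n) := by
    rw [add_sub_cancel]; ring
  simp only [Function.comp]
  rw [e, Complex.exp_nat_mul, Complex.exp_log hn]

/-- Lyapunov's central limit theorem for arrays with identically distributed rows, in terms of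
characteristic functions. -/
lemma tendsto_integral_exp_pow {Ω : Type*} [MeasurableSpace Ω] {P : Measure Ω}
    [IsProbabilityMeasure P] {Y : ℕ → Ω → ℝ} {m : ℕ → ℕ} {σ : ℝ} (hm : Tendsto m atTop atTop)
    (hY : ∀ᶠ n in atTop, MemLp (Y n) 3 P) (h0 : ∀ᶠ n in atTop, ∫ ω, Y n ω ∂P = 0)
    (h2 : Tendsto (fun n => m n * ∫ ω, Y n ω ^ 2 ∂P) atTop (𝓝 σ))
    (h3 : Tendsto (fun n => m n * ∫ ω, |Y n ω| ^ 3 ∂P) atTop (𝓝 0)) :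
    Tendsto (fun n => (∫ ω, Complex.exp (Y n ω * Complex.I) ∂P) ^ m n) atTop
      (𝓝 (Complex.exp (-(σ : ℂ) / 2))) := by
  refine tendsto_pow_cexp hm ?_
  have a : Tendsto (fun n => (m n : ℂ) * (∫ ω, Complex.exp (Y n ω * Complex.I) ∂P -
      (1 - ((∫ ω, Y n ω ^ 2 ∂P : ℝ) : ℂ) / 2))) atTop (𝓝 0) := by
    refine squeeze_zero_norm' (a := fun n => 4 * (m n * ∫ ω, |Y n ω| ^ 3 ∂P)) ?_ ?_
    · filter_upwards [hY, h0] with n hn hn0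
      rw [norm_mul, Complex.norm_natCast]
      calc _ ≤ (m n : ℝ) * (4 * ∫ ω, |Y n ω| ^ 3 ∂P) := by
            gcongr; exact norm_integral_exp_mul_I_sub_le hn hn0
        _ = _ := by ring
    · simpa using h3.const_mul 4
  have b : Tendsto (fun n => -(((m n * ∫ ω, Y n ω ^ 2 ∂P : ℝ) : ℂ)) / 2) atTop
      (𝓝 (-(σ : ℂ) / 2)) :=
    (((Complex.continuous_ofReal.tendsto σ).comp h2).neg).div_const 2
  have c := a.add b
  rw [zero_add] at c
  refine c.congr fun n => ?_
  push_cast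
  ring

/-- Independence factorises the characteristic function, here at argument 1. The functions `g j` may
vary with `j` because the squares in the ratio carry two different weights. -/
lemma integral_exp_sum_eq_prod {Ω S : Type*} [MeasurableSpace Ω] [MeasurableSpace S]
    {P : Measure Ω} [IsProbabilityMeasure P] {X : ℕ → Ω → S} (hX : iIndepFun X P)
    (hXm : ∀ j, AEMeasurable (X j) P) {μ : Measure S} (hμ : ∀ j, P.map (X j) = μ)
    {g : ℕ → S → ℝ} (hg : ∀ j, Measurable (g j)) (s : Finset ℕ) :
    ∫ ω, Complex.exp ((∑ j ∈ s, g j (X j ω) : ℝ) * Complex.I) ∂P =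
      ∏ j ∈ s, ∫ x, Complex.exp (g j x * Complex.I) ∂μ := by
  have hind : iIndepFun (fun j ω => g j (X j ω)) P := hX.comp g hg
  have hm : ∀ j, AEMeasurable (fun ω => g j (X j ω)) P := fun j => (hg j).comp_aemeasurable (hXm j)
  have := congrFun (iIndepFun.charFun_map_fun_finsetSum_eq_prod (s := s) (fun j _ => hm j)
    (hind.restrict s)) 1
  rw [Finset.prod_apply, charFun_apply_real, integral_map (Finset.aemeasurable_fun_sum _ fun j _ => hm j)
    (by fun_prop)] at this
  simp only [Complex.ofReal_one, one_mul] at this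
  rw [this]
  refine Finset.prod_congr rfl fun j _ => ?_
  rw [charFun_apply_real, integral_map (hm j) (by fun_prop), ← hμ j,
    integral_map (hXm j)]
  · simp
  · exact (Measurable.aestronglyMeasurable (by have := hg j; fun_prop))

/-! ### Uniform convergence of multivariate distribution functions -/

lemma exists_Icc_mem_nhds_subset_pi {ι α : Type*} [Finite ι] [TopologicalSpace α] [LinearOrder α]
    [OrderTopology α] {c : ι → α} {s : Set (ι → α)} (hs : s ∈ 𝓝 c) :
    ∃ a b, Set.Icc a b ∈ 𝓝 c ∧ Set.Icc a b ⊆ s := by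
  rw [nhds_pi, Filter.mem_pi] at hs
  obtain ⟨I, -, t, ht, hts⟩ := hs
  choose a b _ hab hsub using fun i => exists_Icc_mem_subset_of_mem_nhds (ht i)
  refine ⟨a, b, ?_, fun x hx => hts fun i _ => hsub i ⟨hx.1 i, hx.2 i⟩⟩
  rw [← Set.pi_univ_Icc]
  exact set_pi_mem_nhds Set.finite_univ fun i _ => hab i

/-- Pólya's theorem: pointwise convergence of monotone functions on a compact product of linear
orders to a continuous function is uniform. -/
lemma tendstoUniformly_of_monotone {ι α : Type*} [Finite ι] [TopologicalSpace α]
    [LinearOrder α] [OrderTopology α] [CompactSpace α] {F : ℕ → (ι → α) → ℝ}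
    {Φ : (ι → α) → ℝ} (hF : ∀ n, Monotone (F n)) (hΦ : Continuous Φ)
    (h : ∀ c, Tendsto (fun n => F n c) atTop (𝓝 (Φ c))) : TendstoUniformly F Φ atTop := by
  -- By compactness it suffices to work near each `c`. On a small box `[a, b]` monotonicity traps `F
  -- n y` between `F n a` and `F n b`. The errors are `ε/3` each: convergence at a corner, corner
  -- against `c`, and `c` against `y`.
  rw [← tendstoLocallyUniformly_iff_tendstoUniformly_of_compactSpace,
    Metric.tendstoLocallyUniformly_iff]
  intro ε hε c
  obtain ⟨a, b, hab, hsub⟩ := exists_Icc_mem_nhds_subset_pi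
    (hΦ.continuousAt.preimage_mem_nhds (Metric.ball_mem_nhds (Φ c) (by positivity : 0 < ε / 3)))
  refine ⟨_, hab, ?_⟩
  have hc := mem_of_mem_nhds hab
  have hle : a ≤ b := hc.1.trans hc.2
  have ha := hsub (Set.left_mem_Icc.2 hle)
  have hb := hsub (Set.right_mem_Icc.2 hle)
  filter_upwards [(h a).eventually_const_lt (sub_lt_self _ (by positivity : 0 < ε / 3)),
    (h b).eventually_lt_const (lt_add_of_pos_right _ (by positivity : 0 < ε / 3))] with n hna hnb y hy
  have h1 := hF n hy.1
  have h2 := hF n hy.2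
  have h3 := hsub hy
  simp only [Set.mem_preimage, Metric.mem_ball, Real.dist_eq, abs_lt] at ha hb h3
  rw [Real.dist_eq, abs_lt]
  constructor <;> linarith

/-- The lower orthant `{u | u ≤ c}`, where the components of `c` may be infinite. -/
def lowerOrthant {d : ℕ} (c : Fin d → EReal) : Set (EuclideanSpace ℝ (Fin d)) :=
  {u | ∀ i, (u i : EReal) ≤ c i}

section

variable {d : ℕ} {γ : Measure (EuclideanSpace ℝ (Fin d))}

lemma isClosed_lowerOrthant (c : Fin d → EReal) : IsClosed (lowerOrthant c) := by
  simp only [lowerOrthant, Set.ofPred_forall]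
  refine isClosed_iInter fun i => isClosed_le ?_ continuous_const
  exact continuous_coe_real_ereal.comp (by fun_prop)

lemma ae_forall_coe_ne (hγ : ∀ i (x : ℝ), γ {u | u i = x} = 0) (c : Fin d → EReal) :
    ∀ᵐ u ∂γ, ∀ i, (u i : EReal) ≠ c i := by
  rw [ae_all_iff]
  intro i
  induction h : c i using EReal.rec with
  | bot => exact ae_of_all _ fun u => EReal.coe_ne_bot _
  | top => exact ae_of_all _ fun u => EReal.coe_ne_top _
  | coe x =>
    have : γ {u | ¬ ((u i : EReal) ≠ (x : EReal))} = 0 := by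
      simpa using hγ i x
    exact this

/-- The strict orthant is open, so the frontier lies in the null hyperplanes `u i = c i`. -/
lemma measure_frontier_lowerOrthant (hγ : ∀ i (x : ℝ), γ {u | u i = x} = 0) (c : Fin d → EReal) :
    γ (frontier (lowerOrthant c)) = 0 := by
  have h := ae_forall_coe_ne hγ c
  refine measure_mono_null ?_ (ae_iff.1 h)
  rw [(isClosed_lowerOrthant c).frontier_eq]
  rintro u ⟨hu, hu'⟩ hne
  apply hu'
  have hopen : IsOpen {u : EuclideanSpace ℝ (Fin d) | ∀ i, (u i : EReal) < c i} := by
    simp only [Set.ofPred_forall]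
    refine isOpen_iInter_of_finite fun i => isOpen_lt ?_ continuous_const
    exact continuous_coe_real_ereal.comp (by fun_prop)
  exact mem_interior.2 ⟨_, fun v hv i => (hv i).le, hopen, fun i => lt_of_le_of_ne (hu i) (hne i)⟩

/-- For `u` off the null hyperplanes `u i = c i`, membership in the orthant does not change under
small perturbations of `c`; hence the indicators converge almost everywhere. -/
lemma continuous_measureReal_lowerOrthant [IsFiniteMeasure γ]
    (hγ : ∀ i (x : ℝ), γ {u | u i = x} = 0) :
    Continuous fun c : Fin d → EReal => γ.real (lowerOrthant c) := by
  refine continuous_iff_continuousAt.2 fun c => ?_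
  refine (ENNReal.tendsto_toReal (measure_ne_top γ _)).comp ?_
  refine tendsto_measure_of_ae_tendsto_indicator_of_isFiniteMeasure _
    (isClosed_lowerOrthant c).measurableSet (fun c' => (isClosed_lowerOrthant c').measurableSet) ?_
  filter_upwards [ae_forall_coe_ne hγ c] with u hu
  have : ∀ᶠ c' in 𝓝 c, ∀ i, ((u i : EReal) ≤ c' i ↔ (u i : EReal) ≤ c i) := by
    rw [eventually_all]
    intro i
    have hi : Tendsto (fun c' : Fin d → EReal => c' i) (𝓝 c) (𝓝 (c i)) :=
      (continuous_apply i).tendsto c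
    rcases lt_or_gt_of_ne (hu i) with h | h
    · filter_upwards [hi.eventually_const_lt h] with c' hc'
      exact ⟨fun _ => h.le, fun _ => hc'.le⟩
    · filter_upwards [hi.eventually_lt_const h] with c' hc'
      exact ⟨fun h' => absurd h' (not_le.2 hc'), fun h' => absurd h' (not_le.2 h)⟩
  filter_upwards [this] with c' hc'
  exact forall_congr' hc'

/-- If, for all `y`, the event `R n ≤ y` eventually agrees componentwise with `U n ≤ y` for random
vectors `U n` converging in distribution to `γ`, then the distribution functions of `R n` converge
uniformly to that of `γ`. -/
lemma tendstoUniformly_distribution {Ω : Type*} [MeasurableSpace Ω] {P : Measure Ω}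
    [IsProbabilityMeasure P] [IsProbabilityMeasure γ]
    (hγ : ∀ i (x : ℝ), γ {u | u i = x} = 0) (R : ℕ → Ω → Fin d → ℝ)
    (hR : ∀ y : Fin d → ℝ, ∃ U : ℕ → Ω → EuclideanSpace ℝ (Fin d), (∀ n, AEMeasurable (U n) P) ∧
      (∀ t, Tendsto (fun n => charFun (P.map (U n)) t) atTop (𝓝 (charFun γ t))) ∧
      ∀ᶠ n in atTop, ∀ᵐ ω ∂P, ∀ i, R n ω i ≤ y i ↔ U n ω i ≤ y i) :
    TendstoUniformly (fun n (y : Fin d → ℝ) => P.real {ω | ∀ i, R n ω i ≤ y i})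
      (fun y => γ.real (lowerOrthant fun i => (y i : EReal))) atTop := by
  -- Extended real thresholds make the parameter space compact, as Pólya's theorem requires;
  -- restriction to real thresholds comes last.
  have key : TendstoUniformly
      (fun n (c : Fin d → EReal) => P.real {ω | ∀ i, (R n ω i : EReal) ≤ c i})
      (fun c => γ.real (lowerOrthant c)) atTop := by
    refine tendstoUniformly_of_monotone (fun n c c' h => ?_)
      (continuous_measureReal_lowerOrthant hγ) fun c => ?_
    · exact measureReal_mono fun ω hω i => (hω i).trans (h i)
    -- Infinite thresholds get the dummy value 0. This is harmless: `⊤` imposes no constraint on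
    -- either vector and `⊥` is satisfied by neither.
    obtain ⟨U, hU, hUt, hUR⟩ := hR fun i => (c i).toReal
    have hlim := ProbabilityMeasure.tendsto_of_tendsto_charFun
      (μ := fun n => ⟨P.map (U n), Measure.isProbabilityMeasure_map (hU n)⟩) (μ₀ := ⟨γ, ‹_›⟩) hUt
    have h1 := ProbabilityMeasure.tendsto_measure_of_null_frontier_of_tendsto' hlim
      (E := lowerOrthant c) (measure_frontier_lowerOrthant hγ c)
    have h2 := (ENNReal.tendsto_toReal (measure_ne_top γ (lowerOrthant c))).comp h1
    refine h2.congr' ?_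
    filter_upwards [hUR] with n hn
    simp only [Function.comp, ProbabilityMeasure.coe_mk]
    rw [Measure.map_apply_of_aemeasurable (hU n) (isClosed_lowerOrthant c).measurableSet]
    refine congrArg ENNReal.toReal (measure_congr ?_)
    filter_upwards [hn] with ω hω
    refine propext (forall_congr' fun i => ?_)
    have := hω i
    induction h : c i using EReal.rec with
    | bot => simp
    | top => simp
    | coe x =>
      rw [h] at this
      simpa using this.symm
  have := key.comp fun (y : Fin d → ℝ) i => (y i : EReal)
  simpa [Function.comp_def] using this

end

/-! ### Copulas and `D`-norms -/

lemma measure_ext_of_Iic_pi {d : ℕ} {μ ν : Measure (Fin d → ℝ)} [IsProbabilityMeasure μ]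
    [IsProbabilityMeasure ν] (h : ∀ x, μ (Set.Iic x) = ν (Set.Iic x)) : μ = ν := by
  refine ext_of_generate_finite
    (Set.univ.pi '' Set.univ.pi fun _ : Fin d => Set.range (Set.Iic : ℝ → Set ℝ))
    (generateFrom_eq_pi (fun i => ?_) fun i => ?_).symm ?_ ?_ ?_
  · rw [← borel_eq_generateFrom_Iic, BorelSpace.measurable_eq (α := ℝ)]
  · refine ⟨fun n => Set.Iic (n : ℝ), fun n => ⟨n, rfl⟩, ?_⟩
    exact Set.eq_univ_of_forall fun x => Set.mem_iUnion.2 (exists_nat_ge x)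
  · exact IsPiSystem.pi fun i => isPiSystem_Iic
  · rintro _ ⟨s, hs, rfl⟩
    choose a ha using fun i => hs i (Set.mem_univ i)
    have : Set.univ.pi s = Set.Iic a := by
      rw [← Set.pi_univ_Iic]
      exact Set.pi_congr rfl fun i _ => (ha i).symm
    rw [this]
    exact h a
  · simp

/-- The distribution function determines the law, so every `X j` has the law `μ` that witnesses the
copula property, and the uniform margins of `μ` become available. -/
lemma HasDistributionFunction.map_eq {d : ℕ} {Ω : Type*} [MeasurableSpace Ω] {P : Measure Ω}
    [IsProbabilityMeasure P] {X : Ω → Fin d → ℝ} {C : (Fin d → ℝ) → ℝ}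
    (hX : HasDistributionFunction P X C) {μ : Measure (Fin d → ℝ)} [IsProbabilityMeasure μ]
    (hμ : ∀ x, C x = μ.real (Set.Iic x)) : P.map X = μ := by
  have := Measure.isProbabilityMeasure_map hX.1
  refine measure_ext_of_Iic_pi fun x => ?_
  rw [Measure.map_apply_of_aemeasurable hX.1 measurableSet_Iic]
  have := hX.2 x
  rw [hμ x] at this
  exact (measureReal_eq_measureReal_iff).1 this

section Margins

variable {d : ℕ} {μ : Measure (Fin d → ℝ)}

lemma measureReal_lt_of_uniform_margin {i : Fin d}
    (hμ : μ.map (fun x => x i) = volume.restrict (Set.Icc (0 : ℝ) 1)) {q : ℝ} (h0 : 0 ≤ q)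
    (h1 : q ≤ 1) : μ.real {x | 1 - q < x i} = q := by
  have e : μ.real {x | 1 - q < x i} = (μ.map (fun x => x i)).real (Set.Ioi (1 - q)) := by
    rw [map_measureReal_apply (by fun_prop) measurableSet_Ioi]
    rfl
  rw [e, hμ, measureReal_restrict_apply measurableSet_Ioi]
  have : Set.Ioi (1 - q) ∩ Set.Icc 0 1 = Set.Ioc (1 - q) 1 := by
    ext x
    simp only [Set.mem_inter_iff, Set.mem_Ioi, Set.mem_Icc, Set.mem_Ioc]
    constructor
    · rintro ⟨h, _, h'⟩; exact ⟨h, h'⟩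
    · rintro ⟨h, h'⟩; exact ⟨h, by linarith, h'⟩
  rw [this, Real.volume_real_Ioc_of_le (by linarith)]
  ring

lemma ae_le_one_of_uniform_margins
    (hμ : ∀ i, μ.map (fun x => x i) = volume.restrict (Set.Icc (0 : ℝ) 1)) :
    ∀ᵐ x ∂μ, ∀ i, x i ≤ 1 := by
  rw [ae_all_iff]
  intro i
  have h : ∀ᵐ y ∂(μ.map fun x => x i), y ≤ 1 := by
    rw [hμ i]
    filter_upwards [ae_restrict_mem measurableSet_Icc] with y hy using hy.2
  exact ae_of_ae_map (measurable_pi_apply i).aemeasurable h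

end Margins

section DNorm

variable {d : ℕ} {N : (Fin d → ℝ) → ℝ}

lemma IsDNorm.smul (hN : IsDNorm N) {c : ℝ} (hc : 0 ≤ c) (x : Fin d → ℝ) :
    N (c • x) = c * N x := by
  obtain ⟨ν, _, _, _, h⟩ := hN
  rw [h, h, ← integral_const_mul]
  refine integral_congr_ae (ae_of_all _ fun z => ?_)
  simp only [Pi.smul_apply, smul_eq_mul, abs_mul, abs_of_nonneg hc, mul_assoc]
  exact (Real.mul_iSup_of_nonneg hc _).symm

lemma IsDNorm.map_zero (hN : IsDNorm N) : N 0 = 0 := by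
  simpa using hN.smul le_rfl 0

/-- Pointwise, the maximum for `x` is at most the maximum for `y` plus `∑ |x i - y i| Z i`, and each
`Z i` has mean one. This yields continuity of `N` and the bound `N (e_i + e_j) ≤ 2`. -/
lemma IsDNorm.le_add (hN : IsDNorm N) (x y : Fin d → ℝ) : N x ≤ N y + ∑ i, |x i - y i| := by
  obtain ⟨ν, _, hz, h1, h⟩ := hN
  rcases isEmpty_or_nonempty (Fin d) with hd | hd
  · rw [Subsingleton.elim x y]; simp
  -- A non-integrable function has integral 0 by convention, so mean one forces integrability.
  have hi : ∀ i, Integrable (fun z : Fin d → ℝ => z i) ν := fun i =>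
    .of_integral_ne_zero (by rw [h1 i]; exact one_ne_zero)
  have hS : ∀ w : Fin d → ℝ, Integrable (fun z : Fin d → ℝ => ∑ i, |w i| * z i) ν := fun w =>
    integrable_finsetSum _ fun i _ => (hi i).const_mul _
  have hM : ∀ w : Fin d → ℝ, Integrable (fun z : Fin d → ℝ => ⨆ i, |w i| * z i) ν := fun w => by
    refine (hS w).mono' (Measurable.aestronglyMeasurable ?_) ?_
    · exact Measurable.iSup fun i => by fun_prop
    · filter_upwards [hz] with z hz
      have hnn : ∀ i, 0 ≤ |w i| * z i := fun i => mul_nonneg (abs_nonneg _) (hz i)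
      rw [Real.norm_of_nonneg (Real.iSup_nonneg hnn)]
      exact ciSup_le fun i => Finset.single_le_sum (f := fun i => |w i| * z i)
        (fun j _ => hnn j) (Finset.mem_univ i)
  have e : ∑ i, |x i - y i| = ∫ z, ∑ i, |(x - y) i| * z i ∂ν := by
    rw [integral_finsetSum _ fun i _ => (hi i).const_mul _]
    simp [integral_const_mul, h1]
  rw [h, h, e, ← integral_add (hM y) (hS _)]
  refine integral_mono_ae (hM x) ((hM y).add (hS _)) ?_
  filter_upwards [hz] with z hz
  refine ciSup_le fun i => ?_
  have a : |y i| * z i ≤ ⨆ i, |y i| * z i :=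
    le_ciSup (f := fun i => |y i| * z i) (Set.finite_range _).bddAbove i
  have b : |(x - y) i| * z i ≤ ∑ i, |(x - y) i| * z i :=
    Finset.single_le_sum (f := fun i => |(x - y) i| * z i)
      (fun j _ => mul_nonneg (abs_nonneg _) (hz j)) (Finset.mem_univ i)
  have c : |x i| * z i ≤ |y i| * z i + |(x - y) i| * z i := by
    rw [← add_mul]
    refine mul_le_mul_of_nonneg_right ?_ (hz i)
    have := abs_add_le (y i) (x i - y i)
    simpa using this
  exact c.trans (add_le_add a b)

lemma IsDNorm.continuous (hN : IsDNorm N) : Continuous N := by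
  refine continuous_iff_continuousAt.2 fun y => ?_
  refine tendsto_iff_dist_tendsto_zero.2 (squeeze_zero (fun _ => dist_nonneg) (fun x => ?_)
    (?_ : Tendsto (fun x : Fin d → ℝ => ∑ i, |x i - y i|) (𝓝 y) (𝓝 0)))
  · rw [Real.dist_eq, abs_le]
    have h1 := hN.le_add x y
    have h2 := hN.le_add y x
    simp only [abs_sub_comm (y _)] at h2
    constructor <;> linarith
  · have : Continuous fun x : Fin d → ℝ => ∑ i, |x i - y i| := by fun_prop
    simpa using this.tendsto y

lemma IsDNorm.single_add_single_le (hN : IsDNorm N) (i j : Fin d) :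
    N (Pi.single i 1 + Pi.single j 1) ≤ 2 := by
  refine (hN.le_add _ 0).trans ?_
  rw [hN.map_zero, zero_add]
  calc ∑ l, |(Pi.single i 1 + Pi.single j 1 : Fin d → ℝ) l - (0 : Fin d → ℝ) l|
      ≤ ∑ l, ((Pi.single i 1 : Fin d → ℝ) l + (Pi.single j 1 : Fin d → ℝ) l) := by
        refine Finset.sum_le_sum fun l _ => ?_
        have a : ∀ m : Fin d, 0 ≤ (Pi.single m 1 : Fin d → ℝ) l := fun m => by
          rw [Pi.single_apply]; split_ifs <;> norm_num
        simp only [Pi.zero_apply, sub_zero, Pi.add_apply]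
        rw [abs_of_nonneg (add_nonneg (a i) (a j))]
    _ = 2 := by rw [Finset.sum_add_distrib]; norm_num [Finset.sum_pi_single']

/-- The radicand is nonnegative, so `Real.sqrt` does not truncate. -/
lemma sqrtCovMatrix_sq_of_ne (hN : IsDNorm N) {i j : Fin d} (h : i ≠ j) :
    sqrtCovMatrix N i j ^ 2 = 2 - N (Pi.single i 1 + Pi.single j 1) := by
  simp only [sqrtCovMatrix, Matrix.of_apply, if_neg h]
  exact Real.sq_sqrt (by linarith [hN.single_add_single_le i j])

lemma sqrtCovMatrix_self (N : (Fin d → ℝ) → ℝ) (i : Fin d) : sqrtCovMatrix N i i = 1 := by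
  simp [sqrtCovMatrix]

end DNorm

/-- Upper tail dependence of a copula with a `D`-norm expansion: joint exceedance probabilities,
suitably scaled, converge to `λ_{il} ^ 2`. -/
lemma tendsto_joint_exceedance {d : ℕ} {C N : (Fin d → ℝ) → ℝ} (hN : IsDNorm N)
    (hCN : HasDNormExpansion C N) {μ : Measure (Fin d → ℝ)} [IsProbabilityMeasure μ]
    (hμ : ∀ i, μ.map (fun x => x i) = volume.restrict (Set.Icc (0 : ℝ) 1))
    (hC : ∀ x, C x = μ.real (Set.Iic x)) {r : ℕ → ℝ} {q : ℕ → Fin d → ℝ}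
    (hr : ∀ n, 0 ≤ r n)
    (hq : ∀ i, ∀ᶠ n in atTop, 0 < q n i ∧ q n i < 1) (hq0 : ∀ i, Tendsto (q · i) atTop (𝓝 0))
    (hqr : ∀ i, Tendsto (fun n => r n * q n i) atTop (𝓝 1)) (i l : Fin d) :
    Tendsto (fun n => r n * μ.real ({x | 1 - q n i < x i} ∩ {x | 1 - q n l < x l})) atTop
      (𝓝 (sqrtCovMatrix N i l ^ 2)) := by
  rcases eq_or_ne i l with rfl | hil
  · rw [sqrtCovMatrix_self, one_pow]
    refine (hqr i).congr' ?_
    filter_upwards [hq i] with n hn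
    rw [Set.inter_self, measureReal_lt_of_uniform_margin (hμ i) hn.1.le hn.2.le]
  -- The point `1 - w n` lowers only the thresholds of components `i` and `l`. Since `r n • w n →
  -- e_i + e_l`, homogeneity and continuity of `N` give the limit of `r n * N (w n)`.
  set w : ℕ → Fin d → ℝ := fun n => Pi.single i (q n i) + Pi.single l (q n l) with hw
  have hwi : ∀ n, w n i = q n i := fun n => by simp [hw, hil]
  have hwl : ∀ n, w n l = q n l := fun n => by simp [hw, hil.symm]
  have hwj : ∀ n j, j ≠ i → j ≠ l → w n j = 0 := fun n j h1 h2 => by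
    simp [hw, h1, h2]
  have hw0 : Tendsto w atTop (𝓝 0) := by
    refine tendsto_pi_nhds.2 fun j => ?_
    by_cases h1 : j = i
    · subst h1; simpa only [hwi, Pi.zero_apply] using hq0 j
    by_cases h2 : j = l
    · subst h2; simpa only [hwl, Pi.zero_apply] using hq0 j
    simpa only [hwj _ j h1 h2, Pi.zero_apply] using tendsto_const_nhds
  have hrw : Tendsto (fun n => r n • w n) atTop (𝓝 (Pi.single i 1 + Pi.single l 1)) := by
    refine tendsto_pi_nhds.2 fun j => ?_
    by_cases h1 : j = i
    · subst h1
      simpa [hwi, Pi.single_apply, hil] using hqr j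
    by_cases h2 : j = l
    · subst h2
      simpa [hwl, Pi.single_apply, h1] using hqr j
    simp [hwj _ j h1 h2, h1, h2]
  have hNw : Tendsto (fun n => r n * N (w n)) atTop (𝓝 (N (Pi.single i 1 + Pi.single l 1))) := by
    refine ((hN.continuous.tendsto _).comp hrw).congr fun n => ?_
    exact hN.smul (hr n) _
  have hu : Tendsto (fun n => 1 - w n) atTop (𝓝[Set.Icc 0 1] 1) := by
    refine tendsto_nhdsWithin_iff.2 ⟨by simpa using hw0.const_sub 1, ?_⟩
    filter_upwards [hq i, hq l] with n hn1 hn2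
    have : ∀ j, 0 ≤ w n j ∧ w n j ≤ 1 := fun j => by
      by_cases h1 : j = i
      · subst h1; rw [hwi]; exact ⟨hn1.1.le, hn1.2.le⟩
      by_cases h2 : j = l
      · subst h2; rw [hwl]; exact ⟨hn2.1.le, hn2.2.le⟩
      rw [hwj n j h1 h2]; norm_num
    exact ⟨fun j => by simpa using (this j).2, fun j => by simpa using (this j).1⟩
  have hO : (fun n => r n * (C (1 - w n) - (1 - N (w n)))) =o[atTop] fun n => r n * ‖w n‖ := by
    have := hCN.comp_tendsto hu
    simp only [Function.comp_def, sub_sub_cancel] at this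
    exact (isBigO_refl r atTop).mul_isLittleO this
  -- The scaled error is `o(r ‖w‖)`, and `r ‖w‖ = ‖r • w‖` is bounded.
  have hO' : Tendsto (fun n => r n * (C (1 - w n) - (1 - N (w n)))) atTop (𝓝 0) := by
    refine hO.trans_isBigO (?_ : _ =O[atTop] fun _ => (1 : ℝ)) |>.tendsto_div_nhds_zero.congr ?_
    · have := (hrw.norm.isBigO_one ℝ)
      refine this.congr_left fun n => ?_
      rw [norm_smul, Real.norm_of_nonneg (hr n)]
    · intro n; simp
  have hlim := (((hqr i).add (hqr l)).sub hNw).add hO'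
  rw [sqrtCovMatrix_sq_of_ne hN hil]
  norm_num at hlim
  refine hlim.congr' ?_
  filter_upwards [hq i, hq l] with n hn1 hn2
  set A := {x : Fin d → ℝ | 1 - q n i < x i}
  set B := {x : Fin d → ℝ | 1 - q n l < x l}
  have hA : MeasurableSet A := measurableSet_lt measurable_const (measurable_pi_apply i)
  have hB : MeasurableSet B := measurableSet_lt measurable_const (measurable_pi_apply l)
  have hAq : μ.real A = q n i := measureReal_lt_of_uniform_margin (hμ i) hn1.1.le hn1.2.le
  have hBq : μ.real B = q n l := measureReal_lt_of_uniform_margin (hμ l) hn2.1.le hn2.2.le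
  have hAB := measureReal_union_add_inter (μ := μ) (s := A) hB
  -- The remaining components have threshold 1, which is almost surely not exceeded, so failing `x ≤
  -- 1 - w n` means exceeding in component `i` or `l`.
  have hcompl : μ.real (A ∪ B) = 1 - C (1 - w n) := by
    rw [hC, ← probReal_compl_eq_one_sub measurableSet_Iic]
    refine measureReal_congr ?_
    filter_upwards [ae_le_one_of_uniform_margins hμ] with x hx
    refine propext ?_
    change (1 - q n i < x i ∨ 1 - q n l < x l) ↔ ¬ (x ≤ 1 - w n)
    rw [Pi.le_def, not_forall]
    constructor
    · rintro (h | h)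
      · exact ⟨i, by simpa [hwi] using h⟩
      · exact ⟨l, by simpa [hwl] using h⟩
    · rintro ⟨j, hj⟩
      by_cases h1 : j = i
      · subst h1; left; simpa [hwi] using hj
      by_cases h2 : j = l
      · subst h2; right; simpa [hwl] using hj
      · simp [hwj n j h1 h2] at hj
        exact absurd (hx j) (not_le.2 hj)
  have : μ.real (A ∩ B) = q n i + q n l - N (w n) + (C (1 - w n) - (1 - N (w n))) := by
    rw [hAq, hBq, hcompl] at hAB
    linarith
  rw [this]
  ring

/-! ### The intermediate tail levels -/

/-- The tail probability `k/n - √k/n * t` of the threshold `1 - k/n + √k/n * t`. -/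
noncomputable def tailLevel (k : ℕ → ℕ) (t : ℝ) (n : ℕ) : ℝ :=
  ((k n : ℝ) - √(k n : ℝ) * t) / n

section TailLevel

variable {k : ℕ → ℕ}

lemma tendsto_sqrt_natCast_atTop (hk_top : Tendsto k atTop atTop) :
    Tendsto (fun n => √(k n : ℝ)) atTop atTop :=
  Real.tendsto_sqrt_atTop.comp (tendsto_natCast_atTop_atTop.comp hk_top)

lemma tendsto_div_mul_tailLevel (hk_top : Tendsto k atTop atTop) (t : ℝ) :
    Tendsto (fun n : ℕ => (n : ℝ) / k n * tailLevel k t n) atTop (𝓝 1) := by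
  have h : Tendsto (fun n => 1 - t * (√(k n : ℝ))⁻¹) atTop (𝓝 1) := by
    simpa using ((tendsto_inv_atTop_zero.comp (tendsto_sqrt_natCast_atTop hk_top)).const_mul
      t).const_sub 1
  refine h.congr' ?_
  filter_upwards [eventually_gt_atTop 0, hk_top.eventually_gt_atTop 0] with n hn hkn
  have hn' : (n : ℝ) ≠ 0 := by positivity
  have hs : √(k n : ℝ) ≠ 0 := by positivity
  have hks : (k n : ℝ) = √(k n : ℝ) ^ 2 := (Real.sq_sqrt (by positivity)).symm
  simp only [tailLevel]
  rw [hks, Real.sqrt_sq (Real.sqrt_nonneg _)]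
  field_simp

lemma tendsto_tailLevel (hk_top : Tendsto k atTop atTop)
    (hk_zero : Tendsto (fun n => (k n : ℝ) / (n : ℝ)) atTop (𝓝 0)) (t : ℝ) :
    Tendsto (tailLevel k t) atTop (𝓝 0) := by
  have h := hk_zero.mul (tendsto_div_mul_tailLevel hk_top t)
  rw [zero_mul] at h
  refine h.congr' ?_
  filter_upwards [eventually_gt_atTop 0, hk_top.eventually_gt_atTop 0] with n hn hkn
  field_simp

lemma eventually_tailLevel_mem (hk_top : Tendsto k atTop atTop)
    (hk_zero : Tendsto (fun n => (k n : ℝ) / (n : ℝ)) atTop (𝓝 0)) (t : ℝ) :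
    ∀ᶠ n in atTop, 0 < tailLevel k t n ∧ tailLevel k t n < 1 := by
  filter_upwards [(tendsto_div_mul_tailLevel hk_top t).eventually_const_lt one_pos,
    (tendsto_tailLevel hk_top hk_zero t).eventually_lt_const one_pos] with n h1 h2
  exact ⟨pos_of_mul_pos_right h1 (by positivity), h2⟩

/-- This one rearrangement serves both the order statistics and the ratios, so both are normalised
identically. -/
lemma affine_le_iff_le_one_sub_tailLevel {n : ℕ} (hn : 0 < n) (hk : 0 < k n) (x t : ℝ) :
    ((n : ℝ) * (x - 1) + k n) / √(k n : ℝ) ≤ t ↔ x ≤ 1 - tailLevel k t n := by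
  have hs : 0 < √(k n : ℝ) := by positivity
  have hn' : (0 : ℝ) < n := by positivity
  rw [div_le_iff₀ hs, tailLevel, le_sub_comm, div_le_iff₀ hn']
  constructor <;> intro h <;> linarith

end TailLevel

/-! ### Quadratic forms and characteristic functions -/

lemma integral_sum_mul_sq {ι S : Type*} [Fintype ι] [MeasurableSpace S] {μ : Measure S}
    {h : ι → S → ℝ} (hi : ∀ i l, Integrable (fun x => h i x * h l x) μ) (v : ι → ℝ) :
    ∫ x, (∑ i, v i * h i x) ^ 2 ∂μ = ∑ i, ∑ l, v i * v l * ∫ x, h i x * h l x ∂μ := by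
  have e : ∀ x, (∑ i, v i * h i x) ^ 2 = ∑ i, ∑ l, v i * v l * (h i x * h l x) := fun x => by
    rw [sq, Finset.sum_mul_sum]
    exact Finset.sum_congr rfl fun i _ => Finset.sum_congr rfl fun l _ => by ring
  simp_rw [e]
  rw [integral_finsetSum _ fun i _ => integrable_finsetSum _ fun l _ => (hi i l).const_mul _]
  refine Finset.sum_congr rfl fun i _ => ?_
  rw [integral_finsetSum _ fun l _ => (hi i l).const_mul _]
  exact Finset.sum_congr rfl fun l _ => integral_const_mul _ _

lemma charFun_map_eq_integral_exp_sum {d : ℕ} {Ω : Type*} [MeasurableSpace Ω] {P : Measure Ω}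
    {U : Ω → EuclideanSpace ℝ (Fin d)} (hU : AEMeasurable U P) (t : EuclideanSpace ℝ (Fin d)) :
    charFun (P.map U) t = ∫ ω, Complex.exp ((∑ i, t i * U ω i : ℝ) * Complex.I) ∂P := by
  rw [charFun_apply, integral_map hU (by fun_prop)]
  simp [PiLp.inner_apply]

lemma charFun_multivariateGaussian_hadamard {d : ℕ} {A : Matrix (Fin d) (Fin d) ℝ}
    (hA : A.PosSemidef) (t : EuclideanSpace ℝ (Fin d)) :
    charFun (multivariateGaussian 0 (A.hadamard A)) t =
      Complex.exp (-((∑ i, ∑ l, t i * t l * A i l ^ 2 : ℝ) : ℂ) / 2) := by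
  rw [charFun_multivariateGaussian (hA.hadamard hA)]
  congr 1
  have : t.ofLp ⬝ᵥ (A.hadamard A).mulVec t.ofLp = ∑ i, ∑ l, t i * t l * A i l ^ 2 := by
    simp only [dotProduct, Matrix.mulVec, Matrix.hadamard_apply, Finset.mul_sum]
    exact Finset.sum_congr rfl fun i _ => Finset.sum_congr rfl fun l _ => by ring
  rw [this]
  simp [neg_div]

/-! ### Componentwise order statistics -/

/-- The `(n - m)`-th smallest value is at most `x` exactly when at least `n - m` values are, that
is, when at most `m` exceed `x`. The bound `m + 1 ≤ n` keeps the rank at least 1, away from the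
default value of `orderStat`. -/
lemma orderStat_sub_le_iff {n m : ℕ} (hm : m + 1 ≤ n) (z : ℕ → ℝ) (x : ℝ) :
    orderStat (fun j : Fin n => z j) (n - m) ≤ x ↔
      (∑ j ∈ Finset.range n, if x < z j then (1 : ℝ) else 0) ≤ m := by
  have h : 1 ≤ n - m ∧ n - m ≤ n := by omega
  set y : Fin n → ℝ := fun j => z j with hy
  -- Ranks are zero-based here: `n - m - 1 <` count is the same as `n - m ≤` count. Sorting permutes
  -- the sample and leaves the count unchanged.
  have h1 := Tuple.lt_card_le_iff_apply_le_of_monotone (j := ⟨n - m - 1, by omega⟩) (a := x)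
    (Tuple.monotone_sort y)
  have h2 : (Finset.univ.filter fun i => (y ∘ Tuple.sort y) i ≤ x).card =
      (Finset.univ.filter fun i => y i ≤ x).card := by
    refine Finset.card_equiv (Tuple.sort y) fun i => ?_
    simp
  have h3 : (∑ j ∈ Finset.range n, if x < z j then (1 : ℝ) else 0) =
      (Finset.univ.filter fun i => ¬ y i ≤ x).card := by
    rw [Finset.sum_range (fun j => if x < z j then (1 : ℝ) else 0)]
    simp [hy, Finset.sum_boole]
  have h4 := Finset.card_filter_add_card_filter_not (s := (Finset.univ : Finset (Fin n)))
    (fun i => y i ≤ x)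
  rw [Finset.card_univ, Fintype.card_fin] at h4
  rw [h2] at h1
  rw [orderStat, dif_pos h, h3, Nat.cast_le]
  change (y ∘ Tuple.sort y) _ ≤ x ↔ _
  rw [← h1]
  simp only
  omega

section Exceedances

variable {d : ℕ} {C N : (Fin d → ℝ) → ℝ} {k : ℕ → ℕ} {μ : Measure (Fin d → ℝ)}

/-- The centred indicator of an exceedance of the level `1 - q` by the `i`-th component. -/
noncomputable def centredExceedance (i : Fin d) (q : ℝ) (x : Fin d → ℝ) : ℝ :=
  (if 1 - q < x i then 1 else 0) - q

@[fun_prop]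
lemma measurable_centredExceedance (i : Fin d) (q : ℝ) : Measurable (centredExceedance i q) :=
  (Measurable.ite (measurableSet_lt measurable_const (measurable_pi_apply i))
    measurable_const measurable_const).sub_const q

lemma abs_centredExceedance_le (i : Fin d) {q : ℝ} (h0 : 0 ≤ q) (h1 : q ≤ 1) (x : Fin d → ℝ) :
    |centredExceedance i q x| ≤ 1 := by
  rw [centredExceedance, abs_le]
  split_ifs <;> constructor <;> linarith

lemma centredExceedance_eq (i : Fin d) (q : ℝ) (x : Fin d → ℝ) :
    centredExceedance i q x = {x : Fin d → ℝ | 1 - q < x i}.indicator 1 x - q := by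
  simp [centredExceedance, Set.indicator_apply]

lemma integral_centredExceedance [IsProbabilityMeasure μ] {i : Fin d}
    (hμ : μ.map (fun x => x i) = volume.restrict (Set.Icc (0 : ℝ) 1)) {q : ℝ} (h0 : 0 ≤ q)
    (h1 : q ≤ 1) : ∫ x, centredExceedance i q x ∂μ = 0 := by
  have hA : MeasurableSet {x : Fin d → ℝ | 1 - q < x i} :=
    measurableSet_lt measurable_const (measurable_pi_apply i)
  simp_rw [centredExceedance_eq]
  have hi : Integrable ({x : Fin d → ℝ | 1 - q < x i}.indicator (1 : (Fin d → ℝ) → ℝ)) μ :=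
    (integrable_indicator_iff hA).2 (integrable_const (1 : ℝ)).integrableOn
  rw [integral_sub hi (integrable_const _), integral_indicator_one hA, measureReal_lt_of_uniform_margin hμ h0 h1]
  simp

lemma integral_centredExceedance_mul [IsProbabilityMeasure μ]
    (hμ : ∀ i, μ.map (fun x => x i) = volume.restrict (Set.Icc (0 : ℝ) 1)) {i l : Fin d}
    {q q' : ℝ} (h0 : 0 ≤ q) (h1 : q ≤ 1) (h0' : 0 ≤ q') (h1' : q' ≤ 1) :
    ∫ x, centredExceedance i q x * centredExceedance l q' x ∂μ =
      μ.real ({x | 1 - q < x i} ∩ {x | 1 - q' < x l}) - q * q' := by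
  have hA : MeasurableSet {x : Fin d → ℝ | 1 - q < x i} :=
    measurableSet_lt measurable_const (measurable_pi_apply i)
  have hB : MeasurableSet {x : Fin d → ℝ | 1 - q' < x l} :=
    measurableSet_lt measurable_const (measurable_pi_apply l)
  have e : ∀ x : Fin d → ℝ, centredExceedance i q x * centredExceedance l q' x =
      ({x : Fin d → ℝ | 1 - q < x i} ∩ {x | 1 - q' < x l}).indicator 1 x - q * q' -
        q' * centredExceedance i q x - q * centredExceedance l q' x := fun x => by
    simp only [centredExceedance_eq, Set.inter_indicator_one, Pi.mul_apply]
    ring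
  have hi : ∀ (i : Fin d) {q : ℝ}, 0 ≤ q → q ≤ 1 → Integrable (centredExceedance i q) μ :=
    fun i q h0 h1 => Integrable.of_bound (C := 1) (by fun_prop)
      (ae_of_all _ fun x => abs_centredExceedance_le i h0 h1 x)
  have j1 : Integrable (fun x : Fin d → ℝ =>
      ({x : Fin d → ℝ | 1 - q < x i} ∩ {x | 1 - q' < x l}).indicator (1 : (Fin d → ℝ) → ℝ) x) μ :=
    (integrable_indicator_iff (hA.inter hB)).2 (integrable_const (1 : ℝ)).integrableOn
  have j2 := j1.sub (integrable_const (q * q'))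
  have j3 := j2.sub ((hi i h0 h1).const_mul q')
  simp only [Pi.sub_def] at j2 j3
  simp_rw [e]
  rw [integral_sub j3 ((hi l h0' h1').const_mul q), integral_sub j2 ((hi i h0 h1).const_mul q'),
    integral_sub j1 (integrable_const (q * q')), integral_const_mul q' (centredExceedance i q),
    integral_const_mul q (centredExceedance l q'),
    integral_centredExceedance (hμ i) h0 h1, integral_centredExceedance (hμ l) h0' h1',
    integral_indicator_one (hA.inter hB)]
  simp

/-- Lyapunov's theorem for linear combinations of the exceedances. The covariances, scaled by `n /
k`, tend to `λ_{il}²`, since the product of the two tail levels is of smaller order than `k / n`. -/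
lemma tendsto_charFun_exceedances (hN : IsDNorm N)
    (hCN : HasDNormExpansion C N) [IsProbabilityMeasure μ]
    (hμ : ∀ i, μ.map (fun x => x i) = volume.restrict (Set.Icc (0 : ℝ) 1))
    (hC : ∀ x, C x = μ.real (Set.Iic x)) (hk_top : Tendsto k atTop atTop)
    (hk_zero : Tendsto (fun n => (k n : ℝ) / (n : ℝ)) atTop (𝓝 0)) (y t : Fin d → ℝ) :
    Tendsto (fun n => (∫ x, Complex.exp ((∑ i, t i / √(k n : ℝ) *
      centredExceedance i (tailLevel k (y i) n) x : ℝ) * Complex.I) ∂μ) ^ n) atTop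
      (𝓝 (Complex.exp (-((∑ i, ∑ l, t i * t l * sqrtCovMatrix N i l ^ 2 : ℝ) : ℂ) / 2))) := by
  set q : ℕ → Fin d → ℝ := fun n i => tailLevel k (y i) n with hq
  set g : ℕ → (Fin d → ℝ) → ℝ := fun n x =>
    ∑ i, t i / √(k n : ℝ) * centredExceedance i (q n i) x with hg
  have hqmem : ∀ᶠ n in atTop, ∀ i, 0 < q n i ∧ q n i < 1 :=
    eventually_all.2 fun i => eventually_tailLevel_mem hk_top hk_zero (y i)
  have hgm : ∀ n, Measurable (g n) := fun n => by fun_prop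
  set T := ∑ i, |t i| with hT
  have hbound : ∀ᶠ n in atTop, ∀ x, |g n x| ≤ T / √(k n : ℝ) := by
    filter_upwards [hqmem] with n hn x
    refine (Finset.abs_sum_le_sum_abs _ _).trans ?_
    rw [hT, Finset.sum_div]
    refine Finset.sum_le_sum fun i _ => ?_
    rw [abs_mul, abs_div, abs_of_nonneg (Real.sqrt_nonneg _)]
    exact mul_le_of_le_one_right (by positivity)
      (abs_centredExceedance_le i (hn i).1.le (hn i).2.le x)
  have hLp : ∀ᶠ n in atTop, MemLp (g n) 3 μ := by
    filter_upwards [hbound] with n hn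
    exact MemLp.of_bound (hgm n).aestronglyMeasurable _ (ae_of_all _ hn)
  have hint : ∀ i {q : ℝ}, 0 ≤ q → q ≤ 1 → Integrable (centredExceedance i q) μ :=
    fun i q h0 h1 => Integrable.of_bound (C := 1) (by fun_prop)
      (ae_of_all _ fun x => abs_centredExceedance_le i h0 h1 x)
  have hg2 : Tendsto (fun n : ℕ => (n : ℝ) * ∫ x, g n x ^ 2 ∂μ) atTop
      (𝓝 (∑ i, ∑ l, t i * t l * sqrtCovMatrix N i l ^ 2)) := by
    have hlim : Tendsto (fun n : ℕ => ∑ i, ∑ l, t i * t l *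
        ((n : ℝ) / k n * μ.real ({x | 1 - q n i < x i} ∩ {x | 1 - q n l < x l}) -
          (n : ℝ) / k n * q n i * q n l)) atTop
        (𝓝 (∑ i, ∑ l, t i * t l * (sqrtCovMatrix N i l ^ 2 - 1 * 0))) := by
      refine tendsto_finsetSum _ fun i _ => tendsto_finsetSum _ fun l _ => Tendsto.const_mul _ ?_
      refine Tendsto.sub ?_ ((tendsto_div_mul_tailLevel hk_top _).mul
        (tendsto_tailLevel hk_top hk_zero _))
      exact tendsto_joint_exceedance hN hCN hμ hC (fun n => by positivity)
        (fun i => eventually_tailLevel_mem hk_top hk_zero (y i))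
        (fun i => tendsto_tailLevel hk_top hk_zero _)
        (fun i => tendsto_div_mul_tailLevel hk_top _) i l
    simp only [mul_zero, sub_zero] at hlim
    refine hlim.congr' ?_
    filter_upwards [hqmem, hk_top.eventually_gt_atTop 0] with n hn hkn
    rw [hg, integral_sum_mul_sq (h := fun i => centredExceedance i (q n i))]
    · rw [Finset.mul_sum]
      refine Finset.sum_congr rfl fun i _ => ?_
      rw [Finset.mul_sum]
      refine Finset.sum_congr rfl fun l _ => ?_
      rw [integral_centredExceedance_mul hμ (hn i).1.le (hn i).2.le (hn l).1.le (hn l).2.le]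
      have hs : √(k n : ℝ) * √(k n : ℝ) = k n := Real.mul_self_sqrt (by positivity)
      rw [div_mul_div_comm, hs]
      have hk0 : (k n : ℝ) ≠ 0 := by positivity
      field_simp
    · intro i l
      refine (hint l (hn l).1.le (hn l).2.le).bdd_mul (c := 1) (by fun_prop)
        (ae_of_all _ fun x => abs_centredExceedance_le i (hn i).1.le (hn i).2.le x)
  refine tendsto_integral_exp_pow (Y := g) tendsto_id hLp ?_ hg2 ?_
  · filter_upwards [hqmem] with n hn
    simp only [hg]
    rw [integral_finsetSum _ fun i _ => (hint i (hn i).1.le (hn i).2.le).const_mul _]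
    refine Finset.sum_eq_zero fun i _ => ?_
    rw [integral_const_mul, integral_centredExceedance (hμ i) (hn i).1.le (hn i).2.le, mul_zero]
  -- The summand is bounded by `T / √k`, so its third absolute moment is at most `T / √k` times its
  -- second moment.
  · have h0 : Tendsto (fun n : ℕ => T / √(k n : ℝ) * ((n : ℝ) * ∫ x, g n x ^ 2 ∂μ)) atTop
        (𝓝 0) := by
      have := ((tendsto_sqrt_natCast_atTop hk_top).const_div_atTop T).mul hg2
      rwa [zero_mul] at this
    refine squeeze_zero' (Eventually.of_forall fun n => by positivity) ?_ h0
    filter_upwards [hbound, hLp] with n hn hn'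
    rw [mul_left_comm, ← integral_const_mul (T / √(k n : ℝ))]
    refine mul_le_mul_of_nonneg_left ?_ (by positivity)
    refine integral_mono_of_nonneg (ae_of_all _ fun x => by positivity)
      ((hn'.mono_exponent (by norm_num : (2 : ENNReal) ≤ 3)).integrable_sq.const_mul _)
      (ae_of_all _ fun x => ?_)
    change |g n x| ^ 3 ≤ T / √(k n : ℝ) * g n x ^ 2
    rw [pow_succ', sq_abs]
    exact mul_le_mul_of_nonneg_right (hn x) (sq_nonneg _)

end Exceedances

/-- Uniform asymptotic normality of the distribution function of the componentwise intermediate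
order statistics. -/
theorem tendstoUniformly_componentwiseOrderStat {d : ℕ} {Ω : Type*} [MeasurableSpace Ω]
    {P : Measure Ω} [IsProbabilityMeasure P] {C N : (Fin d → ℝ) → ℝ} (hC : IsCopula C)
    (hN : IsDNorm N) (hCN : HasDNormExpansion C N) {X : ℕ → Ω → Fin d → ℝ}
    (hXindep : iIndepFun X P) (hX : ∀ j, HasDistributionFunction P (X j) C) {k : ℕ → ℕ}
    (hk : ∀ n, 2 ≤ n → 1 ≤ k n ∧ k n ≤ n - 1) (hk_top : Tendsto k atTop atTop)
    (hk_zero : Tendsto (fun n => (k n : ℝ) / (n : ℝ)) atTop (𝓝 0))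
    {γ : Measure (EuclideanSpace ℝ (Fin d))}
    [IsProbabilityMeasure γ] (hγ : ∀ i (x : ℝ), γ {u | u i = x} = 0)
    (hγc : ∀ t, charFun γ t =
      Complex.exp (-((∑ i, ∑ l, t i * t l * sqrtCovMatrix N i l ^ 2 : ℝ) : ℂ) / 2)) :
    TendstoUniformly (fun (n : ℕ) (y : Fin d → ℝ) => P.real {ω | ∀ i,
        ((n : ℝ) * (componentwiseOrderStat (fun j => X j ω) n (n - k n) i - 1) + k n) /
          √(k n : ℝ) ≤ y i})
      (fun y => γ.real (lowerOrthant fun i => (y i : EReal))) atTop := by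
  obtain ⟨μ, _, hμ, hCμ⟩ := hC
  refine tendstoUniformly_distribution hγ _ fun y => ?_
  refine ⟨fun n ω => WithLp.toLp 2 fun i => ∑ j ∈ Finset.range n,
    centredExceedance i (tailLevel k (y i) n) (X j ω) / √(k n : ℝ), fun n => ?_, fun t => ?_, ?_⟩
  · have := fun j => (hX j).1
    refine (PiLp.continuous_toLp 2 _).measurable.comp_aemeasurable (aemeasurable_pi_lambda _
      fun i => Finset.aemeasurable_fun_sum _ fun j _ => AEMeasurable.div_const ?_ _)
    exact (measurable_centredExceedance i _).comp_aemeasurable (this j)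
  · rw [hγc]
    refine (tendsto_charFun_exceedances hN hCN hμ hCμ hk_top hk_zero y t).congr fun n => ?_
    rw [charFun_map_eq_integral_exp_sum]
    · have := integral_exp_sum_eq_prod hXindep (fun j => (hX j).1)
        (fun j => (hX j).map_eq hCμ) (g := fun _ x => ∑ i, t i / √(k n : ℝ) *
          centredExceedance i (tailLevel k (y i) n) x) (fun j => by fun_prop) (Finset.range n)
      rw [Finset.prod_const, Finset.card_range] at this
      rw [← this]
      refine integral_congr_ae (ae_of_all _ fun ω => ?_)
      simp only
      rw [Finset.sum_comm]
      simp only [Finset.mul_sum]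
      congr 3
      refine Finset.sum_congr rfl fun i _ => Finset.sum_congr rfl fun j _ => ?_
      ring
    · have := fun j => (hX j).1
      refine (PiLp.continuous_toLp 2 _).measurable.comp_aemeasurable (aemeasurable_pi_lambda _
        fun i => Finset.aemeasurable_fun_sum _ fun j _ => AEMeasurable.div_const ?_ _)
      exact (measurable_centredExceedance i _).comp_aemeasurable (this j)
  · filter_upwards [eventually_ge_atTop 2] with n hn
    have hkn := hk n hn
    have hs : 0 < √(k n : ℝ) := Real.sqrt_pos.2 (by exact_mod_cast hkn.1)
    refine ae_of_all _ fun ω i => ?_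
    rw [affine_le_iff_le_one_sub_tailLevel (by omega) (by omega)]
    -- With tail level `q`, `n q = k - √k y`; thus a count of at most `k` is a centred count of at
    -- most `√k y`.
    rw [componentwiseOrderStat, orderStat_sub_le_iff (by omega) (fun j => X j ω i)]
    rw [← Finset.sum_div, div_le_iff₀ hs]
    simp only [centredExceedance]
    rw [Finset.sum_sub_distrib, Finset.sum_const, Finset.card_range, nsmul_eq_mul, tailLevel,
      mul_div_cancel₀ _ (by positivity : (n : ℝ) ≠ 0)]
    constructor <;> intro h <;> linarith

/-! ### Fourth moments of Gaussian vectors -/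

lemma integral_pow_four_stdGaussianReal : ∫ x, x ^ 4 ∂(gaussianReal 0 1) = 3 := by
  have h1 : ∫ x : ℝ in Set.Ioi 0, x ^ 4 * Real.exp (-(1 / 2) * x ^ 2) =
      (1 / 2 : ℝ) ^ (-(4 + 1) / 2 : ℝ) * (1 / 2) * Real.Gamma ((4 + 1) / 2) := by
    rw [← integral_rpow_mul_exp_neg_mul_rpow (by norm_num) (by norm_num) (by norm_num)]
    refine setIntegral_congr_fun measurableSet_Ioi fun x _ => ?_
    norm_cast
  have h2 : Real.Gamma ((4 + 1) / 2) = 3 * √Real.pi / 4 := by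
    have := Real.Gamma_nat_add_half 2
    norm_num [Nat.doubleFactorial] at this
    convert! this using 2
    norm_num
  have h3 : (1 / 2 : ℝ) ^ (-(4 + 1) / 2 : ℝ) = 4 * √2 := by
    rw [one_div, Real.inv_rpow (by norm_num), ← Real.rpow_neg (by norm_num), Real.sqrt_eq_rpow,
      show (-(-(4 + 1) / 2) : ℝ) = 2 + 1 / 2 by norm_num, Real.rpow_add (by norm_num)]
    norm_num
  have h4 : ∫ x : ℝ, x ^ 4 * Real.exp (-(1 / 2) * x ^ 2) =
      2 * ∫ x : ℝ in Set.Ioi 0, x ^ 4 * Real.exp (-(1 / 2) * x ^ 2) := by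
    rw [← integral_comp_abs (f := fun x => x ^ 4 * Real.exp (-(1 / 2) * x ^ 2))]
    refine integral_congr_ae (ae_of_all _ fun x => ?_)
    have : |x| ^ 4 = x ^ 4 := by rw [show 4 = 2 * 2 by rfl, pow_mul, sq_abs, pow_mul]
    simp only [this, sq_abs]
  have h5 : ∀ x : ℝ, gaussianPDFReal 0 1 x • x ^ 4 =
      (√(2 * Real.pi))⁻¹ * (x ^ 4 * Real.exp (-(1 / 2) * x ^ 2)) := fun x => by
    rw [gaussianPDFReal]
    simp only [NNReal.coe_one, mul_one, sub_zero, smul_eq_mul]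
    rw [show -x ^ 2 / 2 = -(1 / 2) * x ^ 2 by ring]
    ring
  rw [integral_gaussianReal_eq_integral_smul one_ne_zero]
  simp_rw [h5]
  rw [integral_const_mul, h4, h1, h2, h3, Real.sqrt_mul (by norm_num)]
  have : √Real.pi ≠ 0 := by positivity
  field_simp

lemma integral_pow_four_gaussianReal (v : NNReal) :
    ∫ x, x ^ 4 ∂(gaussianReal 0 v) = 3 * (v : ℝ) ^ 2 := by
  have h := gaussianReal_map_const_mul (μ := 0) (v := 1) (√(v : ℝ))
  have e : gaussianReal 0 v = (gaussianReal 0 1).map (√(v : ℝ) * ·) := by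
    rw [h, mul_zero, mul_one]
    congr 1
    ext
    exact (Real.sq_sqrt v.2).symm
  rw [e, integral_map (by fun_prop) (by fun_prop)]
  simp_rw [mul_pow]
  have hs : √(v : ℝ) ^ 2 = v := Real.sq_sqrt v.2
  rw [integral_const_mul, integral_pow_four_stdGaussianReal]
  linear_combination 3 * (√(v : ℝ) ^ 2 + v) * hs

lemma integral_linear_combination_three {S : Type*} [MeasurableSpace S] {μ : Measure S}
    {f g h : S → ℝ} (hf : Integrable f μ) (hg : Integrable g μ) (hh : Integrable h μ)
    (a b c : ℝ) : ∫ x, (a * f x + b * g x + c * h x) ∂μ =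
      a * ∫ x, f x ∂μ + b * ∫ x, g x ∂μ + c * ∫ x, h x ∂μ := by
  have h1 : Integrable (fun x => a * f x + b * g x) μ := (hf.const_mul a).add (hg.const_mul b)
  rw [integral_add h1 (hh.const_mul c), integral_add (hf.const_mul a) (hg.const_mul b),
    integral_const_mul, integral_const_mul, integral_const_mul]

section GaussianVector

variable {d : ℕ} {A : Matrix (Fin d) (Fin d) ℝ}

lemma memLp_eval_multivariateGaussian (A : Matrix (Fin d) (Fin d) ℝ) (i : Fin d) {p : ENNReal}
    (hp : p ≠ ⊤) : MemLp (fun u : EuclideanSpace ℝ (Fin d) => u i) p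
      (multivariateGaussian 0 A) :=
  (EuclideanSpace.proj i : EuclideanSpace ℝ (Fin d) →L[ℝ] ℝ).comp_memLp'
    (IsGaussian.memLp_id _ p hp)

lemma integrable_eval_pow_multivariateGaussian (A : Matrix (Fin d) (Fin d) ℝ) (i : Fin d)
    (p : ℕ) : Integrable (fun u : EuclideanSpace ℝ (Fin d) => u i ^ p)
      (multivariateGaussian 0 A) := by
  have := (memLp_eval_multivariateGaussian A i (p := p) (by simp)).integrable_norm_pow'
  refine this.mono' (by fun_prop) (ae_of_all _ fun u => ?_)
  rw [norm_pow]

lemma integral_sq_eval_multivariateGaussian (hA : A.PosSemidef) (i : Fin d) :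
    ∫ u, u i ^ 2 ∂(multivariateGaussian 0 A) = A i i := by
  have h := variance_eval_multivariateGaussian (μ := 0) hA i
  rw [variance_of_integral_eq_zero (Measurable.aemeasurable (by fun_prop))] at h
  · exact h
  · have := (EuclideanSpace.proj i : EuclideanSpace ℝ (Fin d) →L[ℝ] ℝ).integral_comp_comm
      (IsGaussian.integrable_id (μ := multivariateGaussian (0 : EuclideanSpace ℝ (Fin d)) A))
    simpa using this

/-- A linear functional of a centred Gaussian vector is a centred real Gaussian, whose law depends
only on its second moment. -/
lemma integral_pow_four_dual_multivariateGaussian (A : Matrix (Fin d) (Fin d) ℝ)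
    (L : StrongDual ℝ (EuclideanSpace ℝ (Fin d))) :
    ∫ u, L u ^ 4 ∂(multivariateGaussian 0 A) =
      3 * (∫ u, L u ^ 2 ∂(multivariateGaussian 0 A)) ^ 2 := by
  have h0 : ∫ u, L u ∂(multivariateGaussian 0 A) = 0 := by
    rw [IsGaussian.integral_dual]; simp
  have hmap := IsGaussian.map_eq_gaussianReal (μ := multivariateGaussian 0 A) L
  rw [h0] at hmap
  have h4 := integral_map (μ := multivariateGaussian 0 A) (φ := L) (f := fun x : ℝ => x ^ 4)
    (by fun_prop) (by fun_prop)
  rw [← h4, hmap, integral_pow_four_gaussianReal, Real.coe_toNNReal _ (variance_nonneg _ _),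
    variance_of_integral_eq_zero (by fun_prop) h0]

lemma integrable_eval_mul_eval_multivariateGaussian (A : Matrix (Fin d) (Fin d) ℝ) (i l : Fin d) :
    Integrable (fun u : EuclideanSpace ℝ (Fin d) => u i * u l) (multivariateGaussian 0 A) :=
  (memLp_eval_multivariateGaussian A i (p := 2) (by simp)).integrable_mul
    (memLp_eval_multivariateGaussian A l (p := 2) (by simp))

lemma integrable_sq_mul_sq_multivariateGaussian (A : Matrix (Fin d) (Fin d) ℝ) (i l : Fin d) :
    Integrable (fun u : EuclideanSpace ℝ (Fin d) => u i ^ 2 * u l ^ 2)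
      (multivariateGaussian 0 A) := by
  refine ((integrable_eval_pow_multivariateGaussian A i 4).add
    (integrable_eval_pow_multivariateGaussian A l 4)).mono' (by fun_prop) (ae_of_all _ fun u => ?_)
  rw [Real.norm_of_nonneg (by positivity), Pi.add_apply]
  nlinarith [sq_nonneg (u i ^ 2 - u l ^ 2), sq_nonneg (u i ^ 2), sq_nonneg (u l ^ 2)]

lemma integral_mul_eval_multivariateGaussian (hA : A.PosSemidef) (i l : Fin d) :
    ∫ u, u i * u l ∂(multivariateGaussian 0 A) = A i l := by
  have h := covariance_eval_multivariateGaussian (μ := 0) hA i l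
  have h0 : ∀ i, ∫ u : EuclideanSpace ℝ (Fin d), u i ∂(multivariateGaussian 0 A) = 0 := fun i => by
    have := (EuclideanSpace.proj i : EuclideanSpace ℝ (Fin d) →L[ℝ] ℝ).integral_comp_comm
      (IsGaussian.integrable_id (μ := multivariateGaussian (0 : EuclideanSpace ℝ (Fin d)) A))
    simpa using this
  rw [covariance_eq_sub (memLp_eval_multivariateGaussian A i (by simp))
    (memLp_eval_multivariateGaussian A l (by simp)), h0, h0] at h
  simpa using h

/-- Polarisation: `(a + b)⁴ + (a - b)⁴ = 2a⁴ + 12a²b² + 2b⁴`, and every fourth power here is one of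
a linear form, whose fourth moment is three times its squared variance. -/
lemma integral_sq_mul_sq_multivariateGaussian (hA : A.PosSemidef) (i l : Fin d) :
    ∫ u, u i ^ 2 * u l ^ 2 ∂(multivariateGaussian 0 A) = A i i * A l l + 2 * A i l ^ 2 := by
  set G := multivariateGaussian (0 : EuclideanSpace ℝ (Fin d)) A
  let p : Fin d → StrongDual ℝ (EuclideanSpace ℝ (Fin d)) :=
    fun i => EuclideanSpace.proj i
  have i2 : ∀ i, Integrable (fun u : EuclideanSpace ℝ (Fin d) => u i ^ 2) G :=
    fun i => integrable_eval_pow_multivariateGaussian A i 2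
  have i4 : ∀ i, Integrable (fun u : EuclideanSpace ℝ (Fin d) => u i ^ 4) G :=
    fun i => integrable_eval_pow_multivariateGaussian A i 4
  have i11 := integrable_eval_mul_eval_multivariateGaussian A i l
  have i22 := integrable_sq_mul_sq_multivariateGaussian A i l
  have m4 : ∀ i, ∫ u, u i ^ 4 ∂G = 3 * A i i ^ 2 := fun i => by
    rw [← integral_sq_eval_multivariateGaussian hA i]
    exact integral_pow_four_dual_multivariateGaussian A (p i)
  have ms : ∀ s : ℝ, s ^ 2 = 1 →
      ∫ u, (u i + s * u l) ^ 2 ∂G = A i i + 2 * s * A i l + A l l := fun s hs => by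
    have e : ∀ u : EuclideanSpace ℝ (Fin d), (u i + s * u l) ^ 2 =
        1 * u i ^ 2 + 2 * s * (u i * u l) + 1 * u l ^ 2 := fun u => by
      linear_combination u l ^ 2 * hs
    simp_rw [e]
    rw [integral_linear_combination_three (i2 i) i11 (i2 l),
      integral_mul_eval_multivariateGaussian hA, integral_sq_eval_multivariateGaussian hA,
      integral_sq_eval_multivariateGaussian hA]
    ring
  have m4s : ∀ s : ℝ, s ^ 2 = 1 →
      ∫ u, (u i + s * u l) ^ 4 ∂G = 3 * (A i i + 2 * s * A i l + A l l) ^ 2 := fun s hs => by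
    rw [← ms s hs]
    exact integral_pow_four_dual_multivariateGaussian A (p i + s • p l)
  have i4s : ∀ s : ℝ, Integrable (fun u : EuclideanSpace ℝ (Fin d) => (u i + s * u l) ^ 4) G :=
    fun s => by
      have h : MemLp (fun u : EuclideanSpace ℝ (Fin d) => u i + s * u l) ((4 : ℕ) : ENNReal) G :=
        (memLp_eval_multivariateGaussian A i (by simp)).add
          ((memLp_eval_multivariateGaussian A l (by simp)).const_mul s)
      refine h.integrable_norm_pow'.mono' (by fun_prop) (ae_of_all _ fun u => ?_)
      rw [norm_pow]
  have e : ∀ u : EuclideanSpace ℝ (Fin d), (u i + 1 * u l) ^ 4 + (u i + -1 * u l) ^ 4 =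
      2 * u i ^ 4 + 12 * (u i ^ 2 * u l ^ 2) + 2 * u l ^ 4 := fun u => by ring
  have h := integral_congr_ae (μ := G) (ae_of_all _ e)
  rw [integral_add (i4s 1) (i4s (-1)), m4s 1 (by norm_num), m4s (-1) (by norm_num),
    integral_linear_combination_three (i4 i) i22 (i4 l), m4, m4] at h
  linarith

/-- Used twice: the limit law has atomless margins, and the sums of squares in the denominators are
almost surely nonzero. -/
lemma multivariateGaussian_eval_eq_zero (hA : A.PosSemidef) {i : Fin d} (hAi : A i i = 1) (x : ℝ) :
    multivariateGaussian 0 A {u | u i = x} = 0 := by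
  have h := (measurePreserving_eval_multivariateGaussian (μ := 0) hA (i := i)).measure_preimage
    (measurableSet_singleton x).nullMeasurableSet
  have := nullSingletonClass_gaussianReal (μ := (0 : ℝ)) (v := 1) one_ne_zero
  have e : (fun u : EuclideanSpace ℝ (Fin d) => u i) ⁻¹' {x} = {u | u i = x} := rfl
  rw [e, hAi] at h
  rw [h]
  simp

end GaussianVector

/-! ### Sums of centred squares of Gaussian vectors -/

section CentredSquares

variable {d : ℕ} {A : Matrix (Fin d) (Fin d) ℝ}

/-- The centred square of the `i`-th component. -/
def centredSquare (i : Fin d) (u : EuclideanSpace ℝ (Fin d)) : ℝ := u i ^ 2 - 1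

@[fun_prop]
lemma measurable_centredSquare (i : Fin d) : Measurable (centredSquare i) := by
  unfold centredSquare; fun_prop

lemma memLp_centredSquare (A : Matrix (Fin d) (Fin d) ℝ) (i : Fin d) :
    MemLp (centredSquare i) 3 (multivariateGaussian 0 A) := by
  refine MemLp.sub ?_ (memLp_const (1 : ℝ))
  rw [← integrable_norm_rpow_iff (by fun_prop) (by norm_num) (by norm_num)]
  refine (integrable_eval_pow_multivariateGaussian A i 6).congr (ae_of_all _ fun u => ?_)
  simp only [ENNReal.toReal_ofNat, norm_pow, Real.norm_eq_abs, sq_abs]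
  norm_cast
  rw [← pow_mul]

lemma integral_centredSquare (hA : A.PosSemidef) {i : Fin d} (hAi : A i i = 1) :
    ∫ u, centredSquare i u ∂(multivariateGaussian 0 A) = 0 := by
  unfold centredSquare
  rw [integral_sub (integrable_eval_pow_multivariateGaussian A i 2) (integrable_const _),
    integral_sq_eval_multivariateGaussian hA, hAi]
  simp

lemma integrable_centredSquare_mul (A : Matrix (Fin d) (Fin d) ℝ) (i l : Fin d) :
    Integrable (fun u => centredSquare i u * centredSquare l u) (multivariateGaussian 0 A) :=
  ((memLp_centredSquare A i).mono_exponent (by norm_num : (2 : ENNReal) ≤ 3)).integrable_mul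
    ((memLp_centredSquare A l).mono_exponent (by norm_num : (2 : ENNReal) ≤ 3))

/-- Squaring the components squares their correlations; this produces the Hadamard square of `A` in
the limit. -/
lemma integral_centredSquare_mul (hA : A.PosSemidef) (hA1 : ∀ i, A i i = 1) (i l : Fin d) :
    ∫ u, centredSquare i u * centredSquare l u ∂(multivariateGaussian 0 A) = 2 * A i l ^ 2 := by
  have e : ∀ u : EuclideanSpace ℝ (Fin d), centredSquare i u * centredSquare l u =
      1 * (u i ^ 2 * u l ^ 2) + -1 * u i ^ 2 + -1 * centredSquare l u := fun u => by
    unfold centredSquare; ring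
  simp_rw [e]
  rw [integral_linear_combination_three (integrable_sq_mul_sq_multivariateGaussian A i l)
    (integrable_eval_pow_multivariateGaussian A i 2)
    ((memLp_centredSquare A l).integrable (by norm_num)),
    integral_sq_mul_sq_multivariateGaussian hA, integral_sq_eval_multivariateGaussian hA,
    integral_centredSquare hA (hA1 l), hA1, hA1]
  ring

lemma tendsto_charFun_centredSquares (hA : A.PosSemidef) (hA1 : ∀ i, A i i = 1) {m : ℕ → ℕ}
    (hm : Tendsto m atTop atTop) {v : ℕ → Fin d → ℝ} {w : Fin d → ℝ}
    (hv : ∀ i, Tendsto (fun n => √(m n : ℝ) * v n i) atTop (𝓝 (w i))) :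
    Tendsto (fun n => (∫ u, Complex.exp ((∑ i, v n i * centredSquare i u : ℝ) * Complex.I)
      ∂(multivariateGaussian 0 A)) ^ m n) atTop
      (𝓝 (Complex.exp (-((∑ i, ∑ l, w i * w l * (2 * A i l ^ 2) : ℝ) : ℂ) / 2))) := by
  set G := multivariateGaussian (0 : EuclideanSpace ℝ (Fin d)) A
  have hLp : ∀ n, MemLp (fun u => ∑ i, v n i * centredSquare i u) 3 G := fun n =>
    memLp_finsetSum _ fun i _ => (memLp_centredSquare A i).const_mul _
  refine tendsto_integral_exp_pow (Y := fun n u => ∑ i, v n i * centredSquare i u) hm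
    (Eventually.of_forall hLp) (Eventually.of_forall fun n => ?_) ?_ ?_
  · rw [integral_finsetSum _ fun i _ =>
      ((memLp_centredSquare A i).integrable (by norm_num)).const_mul _]
    refine Finset.sum_eq_zero fun i _ => ?_
    rw [integral_const_mul, integral_centredSquare hA (hA1 i), mul_zero]
  · have h : Tendsto (fun n => ∑ i, ∑ l, (√(m n : ℝ) * v n i) * (√(m n : ℝ) * v n l) *
        (2 * A i l ^ 2)) atTop (𝓝 (∑ i, ∑ l, w i * w l * (2 * A i l ^ 2))) :=
      tendsto_finsetSum _ fun i _ => tendsto_finsetSum _ fun l _ =>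
        ((hv i).mul (hv l)).mul_const _
    refine h.congr fun n => ?_
    rw [integral_sum_mul_sq (integrable_centredSquare_mul A), Finset.mul_sum]
    refine Finset.sum_congr rfl fun i _ => ?_
    rw [Finset.mul_sum]
    refine Finset.sum_congr rfl fun l _ => ?_
    rw [integral_centredSquare_mul hA hA1]
    have hs : √(m n : ℝ) * √(m n : ℝ) = m n := Real.mul_self_sqrt (by positivity)
    linear_combination v n i * v n l * (2 * A i l ^ 2) * hs
  · set K := ∫ u, (∑ i, |centredSquare i u|) ^ 3 ∂G with hK
    have hKint : Integrable (fun u => (∑ i, |centredSquare i u|) ^ 3) G := by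
      have h : MemLp (fun u => ∑ i, |centredSquare i u|) ((3 : ℕ) : ENNReal) G := by
        exact_mod_cast memLp_finsetSum _ fun i _ => (memLp_centredSquare A i).norm
      refine (h.integrable_norm_pow three_ne_zero).congr (ae_of_all _ fun u => ?_)
      simp only
      rw [Real.norm_of_nonneg (Finset.sum_nonneg fun i _ => abs_nonneg _)]
    -- Weights of order `1/√m` make `m` times the third moment of order `1/√m`.
    have h1 : Tendsto (fun n => (∑ i, |√(m n : ℝ) * v n i|) ^ 3 * (√(m n : ℝ))⁻¹ * K) atTop
        (𝓝 0) := by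
      have a := (tendsto_finsetSum Finset.univ fun i _ => (hv i).abs).pow 3
      have b := (a.mul (tendsto_inv_atTop_zero.comp (tendsto_sqrt_natCast_atTop hm))).mul_const K
      simpa using b
    refine squeeze_zero' (Eventually.of_forall fun n => by positivity) ?_ h1
    filter_upwards [hm.eventually_gt_atTop 0] with n hn
    have hs : 0 < √(m n : ℝ) := by positivity
    have hs2 : √(m n : ℝ) ^ 2 = m n := Real.sq_sqrt (by positivity)
    have e : (∑ i, |√(m n : ℝ) * v n i|) ^ 3 * (√(m n : ℝ))⁻¹ * K =
        m n * ((∑ i, |v n i|) ^ 3 * K) := by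
      simp_rw [abs_mul, abs_of_pos hs]
      have hc : √(m n : ℝ) ^ 3 * (√(m n : ℝ))⁻¹ = m n := by
        rw [pow_succ, mul_assoc, mul_inv_cancel₀ hs.ne', mul_one, hs2]
      rw [← Finset.mul_sum]
      linear_combination (∑ i, |v n i|) ^ 3 * K * hc
    rw [e, hK, ← integral_const_mul ((∑ i, |v n i|) ^ 3)]
    refine mul_le_mul_of_nonneg_left ?_ (by positivity)
    refine integral_mono_of_nonneg (ae_of_all _ fun u => pow_nonneg (abs_nonneg _) 3)
      (hKint.const_mul _) (ae_of_all _ fun u => ?_)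
    change |∑ i, v n i * centredSquare i u| ^ 3 ≤ (∑ i, |v n i|) ^ 3 *
      (∑ i, |centredSquare i u|) ^ 3
    rw [← mul_pow]
    refine pow_le_pow_left₀ (abs_nonneg _) ((Finset.abs_sum_le_sum_abs _ _).trans ?_) 3
    rw [Finset.mul_sum]
    refine Finset.sum_le_sum fun i _ => ?_
    rw [abs_mul]
    exact mul_le_mul_of_nonneg_right (Finset.single_le_sum (f := fun i => |v n i|)
      (fun j _ => abs_nonneg _) (Finset.mem_univ i)) (abs_nonneg _)

end CentredSquares

/-! ### Ratios of sums of squares -/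

section Ratio

variable {d : ℕ} {A : Matrix (Fin d) (Fin d) ℝ} {k : ℕ → ℕ}

lemma tendsto_two_mul_sub (hk_zero : Tendsto (fun n => (k n : ℝ) / (n : ℝ)) atTop (𝓝 0)) :
    Tendsto (fun n => 2 * (n - k n)) atTop atTop := by
  refine tendsto_atTop_mono' _ ?_ tendsto_id
  filter_upwards [hk_zero.eventually_lt_const (by norm_num : (0 : ℝ) < 1 / 2),
    eventually_gt_atTop 0] with n hn hn0
  have hn0' : (0 : ℝ) < n := by positivity
  rw [div_lt_iff₀ hn0'] at hn
  have : 2 * k n < n := by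
    have : (2 * k n : ℝ) < n := by linarith
    exact_mod_cast this
  simp only [id]
  omega

lemma tendsto_two_mul_add_one (hk_top : Tendsto k atTop atTop) :
    Tendsto (fun n => 2 * (k n + 1)) atTop atTop :=
  tendsto_atTop_mono (fun n => by omega) hk_top

/-- The first block is negligible: `q` is of order `k/n`, so the expression is of order `√n (k/n) /
√k = √(k/n)`. -/
lemma tendsto_sqrt_mul_tailLevel (hk_top : Tendsto k atTop atTop)
    (hk_zero : Tendsto (fun n => (k n : ℝ) / (n : ℝ)) atTop (𝓝 0)) (y t : ℝ) :
    Tendsto (fun n => √((2 * (n - k n) : ℕ) : ℝ) * (t * tailLevel k y n / (2 * √(k n : ℝ))))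
      atTop (𝓝 0) := by
  have h : Tendsto (fun n : ℕ => √2 * |t| / 2 * (√((k n : ℝ) / n) *
      |(n : ℝ) / k n * tailLevel k y n|)) atTop (𝓝 0) := by
    have a := (Real.continuous_sqrt.tendsto _).comp hk_zero
    have b := (a.mul (tendsto_div_mul_tailLevel hk_top y).abs).const_mul (√2 * |t| / 2)
    simpa using b
  refine squeeze_zero_norm' ?_ h
  filter_upwards [eventually_gt_atTop 0, hk_top.eventually_gt_atTop 0] with n hn hkn
  have hs : 0 < √(k n : ℝ) := by positivity
  have hsn : 0 < √(n : ℝ) := by positivity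
  have h1 : √((2 * (n - k n) : ℕ) : ℝ) ≤ √2 * √(n : ℝ) := by
    rw [← Real.sqrt_mul (by norm_num)]
    refine Real.sqrt_le_sqrt ?_
    exact_mod_cast Nat.mul_le_mul_left 2 (Nat.sub_le n (k n))
  rw [Real.norm_eq_abs, abs_mul, abs_div, abs_mul, abs_of_nonneg (Real.sqrt_nonneg _),
    abs_of_pos (by positivity : 0 < 2 * √(k n : ℝ)), abs_mul ((n : ℝ) / k n),
    abs_of_pos (by positivity : 0 < (n : ℝ) / k n), Real.sqrt_div (by positivity)]
  refine (mul_le_mul_of_nonneg_right h1 (by positivity)).trans (le_of_eq ?_)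
  have e1 : (k n : ℝ) = √(k n : ℝ) ^ 2 := (Real.sq_sqrt (by positivity)).symm
  have e2 : (n : ℝ) = √(n : ℝ) ^ 2 := (Real.sq_sqrt (by positivity)).symm
  have e3 : (n : ℝ) / k n = √(n : ℝ) ^ 2 / √(k n : ℝ) ^ 2 := by rw [← e1, ← e2]
  rw [e3]
  field_simp

lemma tendsto_sqrt_mul_one_sub_tailLevel (hk_top : Tendsto k atTop atTop)
    (hk_zero : Tendsto (fun n => (k n : ℝ) / (n : ℝ)) atTop (𝓝 0)) (y t : ℝ) :
    Tendsto (fun n => √((2 * (k n + 1) : ℕ) : ℝ) *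
      (t * (tailLevel k y n - 1) / (2 * √(k n : ℝ)))) atTop (𝓝 (-(√2 * t / 2))) := by
  have h1 : Tendsto (fun n => √(2 * (1 + ((k n : ℝ))⁻¹))) atTop (𝓝 (√2)) := by
    have := ((tendsto_inv_atTop_zero.comp (tendsto_natCast_atTop_atTop.comp hk_top)).const_add
      (1 : ℝ)).const_mul 2
    rw [show 2 * (1 + (0 : ℝ)) = 2 by norm_num] at this
    exact (Real.continuous_sqrt.tendsto _).comp this
  have h2 := h1.mul (((tendsto_tailLevel hk_top hk_zero y).sub_const 1).const_mul (t / 2))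
  have e : √2 * (t / 2 * (0 - 1)) = -(√2 * t / 2) := by ring
  rw [e] at h2
  refine h2.congr' ?_
  filter_upwards [hk_top.eventually_gt_atTop 0] with n hkn
  have hs : 0 < √(k n : ℝ) := by positivity
  have e : √((2 * (k n + 1) : ℕ) : ℝ) = √(2 * (1 + ((k n : ℝ))⁻¹)) * √(k n : ℝ) := by
    rw [← Real.sqrt_mul (by positivity)]
    congr 1
    push_cast
    field_simp
  rw [e]
  field_simp

/-- The weight of the `j`-th square in the linearised event `ratio ≤ 1 - q`. -/
def ratioWeight (p : ℕ) (q : ℝ) (j : ℕ) : ℝ := if j < p then q else q - 1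

/-- The sign of the right side, for `s` the squares, decides whether the ratio is at most `1 - q`.
-/
lemma sum_ratioWeight_mul (p r : ℕ) (q : ℝ) (s : ℕ → ℝ) :
    ∑ j ∈ Finset.range (p + r), ratioWeight p q j * s j =
      q * ∑ j ∈ Finset.range (p + r), s j - (∑ j ∈ Finset.range (p + r), s j -
        ∑ j ∈ Finset.range p, s j) := by
  rw [Finset.sum_range_add, Finset.sum_range_add, add_sub_cancel_left, mul_add, add_sub_assoc,
    Finset.mul_sum, Finset.mul_sum, ← Finset.sum_sub_distrib]
  congr 1
  · refine Finset.sum_congr rfl fun j hj => ?_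
    rw [ratioWeight, if_pos (Finset.mem_range.1 hj)]
  · refine Finset.sum_congr rfl fun j _ => ?_
    rw [ratioWeight, if_neg (by omega)]
    ring

/-- The first block contributes a factor tending to 1. The second has limiting weights `-√2 t_i /
2`, and their factor `1/2` cancels the 2 in the covariance `2 A_{il}²`. -/
lemma tendsto_charFun_ratio {Ω : Type*} [MeasurableSpace Ω] {P : Measure Ω}
    [IsProbabilityMeasure P] (hA : A.PosSemidef) (hA1 : ∀ i, A i i = 1)
    {ξ : ℕ → Ω → EuclideanSpace ℝ (Fin d)} (hindep : iIndepFun ξ P)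
    (hξ : ∀ j, HasLaw (ξ j) (multivariateGaussian 0 A) P)
    (hk : ∀ n, 2 ≤ n → 1 ≤ k n ∧ k n ≤ n - 1) (hk_top : Tendsto k atTop atTop)
    (hk_zero : Tendsto (fun n => (k n : ℝ) / (n : ℝ)) atTop (𝓝 0)) (y t : Fin d → ℝ) :
    Tendsto (fun n => ∫ ω, Complex.exp ((∑ j ∈ Finset.range (2 * (n + 1)), ∑ i,
        t i * ratioWeight (2 * (n - k n)) (tailLevel k (y i) n) j / (2 * √(k n : ℝ)) *
          centredSquare i (ξ j ω) : ℝ) * Complex.I) ∂P) atTop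
      (𝓝 (Complex.exp (-((∑ i, ∑ l, t i * t l * A i l ^ 2 : ℝ) : ℂ) / 2))) := by
  have h1 := tendsto_charFun_centredSquares hA hA1 (tendsto_two_mul_sub hk_zero)
    (v := fun n i => t i * tailLevel k (y i) n / (2 * √(k n : ℝ))) (w := 0)
    (fun i => tendsto_sqrt_mul_tailLevel hk_top hk_zero (y i) (t i))
  have h2 := tendsto_charFun_centredSquares hA hA1 (tendsto_two_mul_add_one hk_top)
    (v := fun n i => t i * (tailLevel k (y i) n - 1) / (2 * √(k n : ℝ)))
    (w := fun i => -(√2 * t i / 2))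
    (fun i => tendsto_sqrt_mul_one_sub_tailLevel hk_top hk_zero (y i) (t i))
  have h := h1.mul h2
  have e : ∀ i l, -(√2 * t i / 2) * -(√2 * t l / 2) * (2 * A i l ^ 2) = t i * t l * A i l ^ 2 :=
    fun i l => by
      have : √2 * √2 = 2 := Real.mul_self_sqrt (by norm_num)
      linear_combination (t i * t l * A i l ^ 2 / 2) * this
  simp only [Pi.zero_apply, zero_mul, Finset.sum_const_zero, Complex.ofReal_zero, neg_zero,
    zero_div, Complex.exp_zero, one_mul, e] at h
  refine h.congr' ?_
  filter_upwards [eventually_ge_atTop 2] with n hn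
  have hkn := hk n hn
  rw [integral_exp_sum_eq_prod hindep (fun j => (hξ j).aemeasurable) (fun j => (hξ j).map_eq)
    (g := fun j u => ∑ i, t i * ratioWeight (2 * (n - k n)) (tailLevel k (y i) n) j /
      (2 * √(k n : ℝ)) * centredSquare i u) (fun j => by fun_prop),
    show 2 * (n + 1) = 2 * (n - k n) + 2 * (k n + 1) by omega, Finset.prod_range_add]
  congr 1
  · rw [Finset.prod_congr rfl fun j hj => ?_, Finset.prod_const, Finset.card_range]
    simp only [ratioWeight, if_pos (Finset.mem_range.1 hj)]
  · rw [Finset.prod_congr rfl fun j hj => ?_, Finset.prod_const, Finset.card_range]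
    simp only [ratioWeight, if_neg (by omega : ¬ (2 * (n - k n) + j < 2 * (n - k n)))]

/-- Uniform asymptotic normality of the distribution function of the ratios of sums of squares. -/
theorem tendstoUniformly_squareSumRatio {Ω : Type*} [MeasurableSpace Ω] {P : Measure Ω}
    [IsProbabilityMeasure P] (hA : A.PosSemidef) (hA1 : ∀ i, A i i = 1)
    {ξ : ℕ → Ω → EuclideanSpace ℝ (Fin d)} (hindep : iIndepFun ξ P)
    (hξ : ∀ j, HasLaw (ξ j) (multivariateGaussian 0 A) P)
    (hk : ∀ n, 2 ≤ n → 1 ≤ k n ∧ k n ≤ n - 1) (hk_top : Tendsto k atTop atTop)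
    (hk_zero : Tendsto (fun n => (k n : ℝ) / (n : ℝ)) atTop (𝓝 0))
    {γ : Measure (EuclideanSpace ℝ (Fin d))} [IsProbabilityMeasure γ]
    (hγ : ∀ i (x : ℝ), γ {u | u i = x} = 0)
    (hγc : ∀ t, charFun γ t =
      Complex.exp (-((∑ i, ∑ l, t i * t l * A i l ^ 2 : ℝ) : ℂ) / 2)) :
    TendstoUniformly (fun (n : ℕ) (y : Fin d → ℝ) => P.real {ω | ∀ i,
        ((n : ℝ) * (squareSumRatio (fun j => ξ j ω) (2 * (n - k n)) (2 * (n + 1)) i - 1) + k n) /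
          √(k n : ℝ) ≤ y i})
      (fun y => γ.real (lowerOrthant fun i => (y i : EReal))) atTop := by
  refine tendstoUniformly_distribution hγ _ fun y => ?_
  -- Centring the squares adds the total weight `2q(n+1) - 2(k+1) = -2√k y - 2(1 - q)`. Division by
  -- `2√k` turns the first term into the threshold `y`; the second leaves the shift `δ`, which tends
  -- to 0 and changes the characteristic function only by a phase tending to 1.
  set δ : ℕ → Fin d → ℝ := fun n i => (1 - tailLevel k (y i) n) / √(k n : ℝ) with hδ
  set U : ℕ → Ω → EuclideanSpace ℝ (Fin d) := fun n ω => WithLp.toLp 2 fun i =>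
    ∑ j ∈ Finset.range (2 * (n + 1)), ratioWeight (2 * (n - k n)) (tailLevel k (y i) n) j /
      (2 * √(k n : ℝ)) * centredSquare i (ξ j ω) - δ n i with hUdef
  have hU : ∀ n, AEMeasurable (U n) P := fun n => by
    have := fun j => (hξ j).aemeasurable
    refine (PiLp.continuous_toLp 2 _).measurable.comp_aemeasurable (aemeasurable_pi_lambda _
      fun i => (Finset.aemeasurable_fun_sum _ fun j _ => AEMeasurable.const_mul ?_ _).sub_const _)
    exact (measurable_centredSquare i).comp_aemeasurable (this j)
  refine ⟨U, hU, fun t => ?_, ?_⟩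
  · rw [hγc]
    have hδ0 : ∀ i, Tendsto (fun n => δ n i) atTop (𝓝 0) := fun i => by
      have := ((tendsto_tailLevel hk_top hk_zero (y i)).const_sub 1).mul
        (tendsto_inv_atTop_zero.comp (tendsto_sqrt_natCast_atTop hk_top))
      simpa [hδ, div_eq_mul_inv] using this
    have hs : Tendsto (fun n => ∑ i, t i * δ n i) atTop (𝓝 0) := by
      simpa using tendsto_finsetSum Finset.univ fun i _ => (hδ0 i).const_mul (t i)
    have he : Tendsto (fun n => Complex.exp ((-(∑ i, t i * δ n i) : ℝ) * Complex.I)) atTop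
        (𝓝 1) := by
      have hc : Continuous fun x : ℝ => Complex.exp ((-x : ℝ) * Complex.I) := by fun_prop
      have h := (hc.tendsto 0).comp hs
      simp only [neg_zero, Complex.ofReal_zero, zero_mul, Complex.exp_zero] at h
      exact h
    have h := he.mul (tendsto_charFun_ratio hA hA1 hindep hξ hk hk_top hk_zero y t)
    rw [one_mul] at h
    refine h.congr fun n => ?_
    rw [charFun_map_eq_integral_exp_sum (hU n), ← integral_const_mul]
    refine integral_congr_ae (ae_of_all _ fun ω => ?_)
    simp only
    rw [← Complex.exp_add, ← add_mul, ← Complex.ofReal_add]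
    congr 3
    simp only [hUdef, mul_sub, Finset.sum_sub_distrib, Finset.mul_sum]
    rw [neg_add_eq_sub, Finset.sum_comm]
    congr 1
    refine Finset.sum_congr rfl fun i _ => Finset.sum_congr rfl fun j _ => ?_
    ring
  · have hpos : ∀ᵐ ω ∂P, ∀ i, ξ 0 ω i ≠ 0 := by
      have h : ∀ᵐ u ∂(multivariateGaussian 0 A), ∀ i, u i ≠ 0 := by
        rw [ae_all_iff]
        intro i
        have := multivariateGaussian_eval_eq_zero hA (hA1 i) 0
        rw [ae_iff]
        simpa using this
      rw [← (hξ 0).map_eq] at h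
      exact ae_of_ae_map (hξ 0).aemeasurable h
    filter_upwards [eventually_ge_atTop 2] with n hn
    have hkn := hk n hn
    have hs : 0 < √(k n : ℝ) := Real.sqrt_pos.2 (by exact_mod_cast hkn.1)
    filter_upwards [hpos] with ω hω i
    rw [affine_le_iff_le_one_sub_tailLevel (by omega) (by omega)]
    set q := tailLevel k (y i) n with hq
    have hqn : (n : ℝ) * q = k n - √(k n : ℝ) * y i := by
      rw [hq, tailLevel, mul_div_cancel₀ _ (by positivity : (n : ℝ) ≠ 0)]
    -- A positive denominator allows the ratio inequality to be cleared; one nonzero square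
    -- suffices.
    have hV : 0 < ∑ j ∈ Finset.range (2 * (n + 1)), ξ j ω i ^ 2 :=
      Finset.sum_pos' (fun j _ => sq_nonneg _) ⟨0, by simp, by have := hω i; positivity⟩
    have hsum : ∑ j ∈ Finset.range (2 * (n + 1)), ratioWeight (2 * (n - k n)) q j *
        centredSquare i (ξ j ω) = q * ∑ j ∈ Finset.range (2 * (n + 1)), ξ j ω i ^ 2 -
          (∑ j ∈ Finset.range (2 * (n + 1)), ξ j ω i ^ 2 -
            ∑ j ∈ Finset.range (2 * (n - k n)), ξ j ω i ^ 2) -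
          (2 * q * (n + 1) - 2 * (k n + 1)) := by
      have e := show 2 * (n + 1) = 2 * (n - k n) + 2 * (k n + 1) by omega
      have h1 := sum_ratioWeight_mul (2 * (n - k n)) (2 * (k n + 1)) q
        (fun j => centredSquare i (ξ j ω))
      rw [← e] at h1
      rw [h1]
      simp only [centredSquare, Finset.sum_sub_distrib, Finset.sum_const, Finset.card_range,
        nsmul_eq_mul, mul_one]
      push_cast [Nat.cast_sub (show k n ≤ n by omega)]
      ring
    have hUi : U n ω i = (∑ j ∈ Finset.range (2 * (n + 1)), ratioWeight (2 * (n - k n)) q j *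
        centredSquare i (ξ j ω)) / (2 * √(k n : ℝ)) - (1 - q) / √(k n : ℝ) := by
      simp only [hUdef, hδ, ← hq, Finset.sum_div]
      congr 1
      exact Finset.sum_congr rfl fun j _ => by ring
    have hiff : U n ω i ≤ y i ↔ q * ∑ j ∈ Finset.range (2 * (n + 1)), ξ j ω i ^ 2 -
          (∑ j ∈ Finset.range (2 * (n + 1)), ξ j ω i ^ 2 -
            ∑ j ∈ Finset.range (2 * (n - k n)), ξ j ω i ^ 2) ≤ 0 := by
      rw [hUi, hsum, sub_le_iff_le_add, div_le_iff₀ (by positivity)]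
      have e : (y i + (1 - q) / √(k n : ℝ)) * (2 * √(k n : ℝ)) =
          2 * (√(k n : ℝ) * y i) + 2 * (1 - q) := by field_simp
      rw [e]
      constructor <;> intro h <;> linarith
    rw [hiff, squareSumRatio, div_le_iff₀ hV]
    constructor <;> intro h <;> linarith

end Ratio

/-! ### Comparison of the two distribution functions -/

theorem corollary2p4 {d : ℕ} {Ω Ω' : Type*} [MeasurableSpace Ω] [MeasurableSpace Ω']
    (P : Measure Ω) [IsProbabilityMeasure P] (P' : Measure Ω') [IsProbabilityMeasure P']
    (C N : (Fin d → ℝ) → ℝ) (hC : IsCopula C) (hN : IsDNorm N) (hCN : HasDNormExpansion C N)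
    (X : ℕ → Ω → Fin d → ℝ) (hXindep : iIndepFun X P)
    (hX : ∀ j, HasDistributionFunction P (X j) C)
    (k : ℕ → ℕ) (hk : ∀ n, 2 ≤ n → 1 ≤ k n ∧ k n ≤ n - 1)
    (hk_top : Tendsto k atTop atTop)
    (hk_zero : Tendsto (fun n => (k n : ℝ) / (n : ℝ)) atTop (𝓝 0))
    (hΛ : (sqrtCovMatrix N).PosSemidef)
    (ξ : ℕ → Ω' → EuclideanSpace ℝ (Fin d)) (hξindep : iIndepFun ξ P')
    (hξ : ∀ j, HasLaw (ξ j) (multivariateGaussian 0 (sqrtCovMatrix N)) P') :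
    Tendsto (fun n : ℕ => ⨆ x : Fin d → ℝ,
      |P.real {ω | componentwiseOrderStat (fun j => X j ω) n (n - k n) ≤ x}
        - P'.real {ω | squareSumRatio (fun j => ξ j ω) (2 * (n - k n)) (2 * (n + 1)) ≤ x}|)
      atTop (𝓝 0) := by
  set γ := multivariateGaussian (0 : EuclideanSpace ℝ (Fin d))
    ((sqrtCovMatrix N).hadamard (sqrtCovMatrix N))
  have hγ : ∀ i (x : ℝ), γ {u | u i = x} = 0 := fun i x =>
    multivariateGaussian_eval_eq_zero (hΛ.hadamard hΛ) (by simp [sqrtCovMatrix_self]) x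
  have hγc := charFun_multivariateGaussian_hadamard hΛ
  have h1 := tendstoUniformly_componentwiseOrderStat hC hN hCN hXindep hX hk hk_top hk_zero hγ hγc
  have h2 := tendstoUniformly_squareSumRatio hΛ (sqrtCovMatrix_self N) hξindep hξ hk hk_top
    hk_zero hγ hγc
  rw [Metric.tendstoUniformly_iff] at h1 h2
  rw [Metric.tendsto_atTop']
  intro ε hε
  have h := (h1 (ε / 4) (by positivity)).and ((h2 (ε / 4) (by positivity)).and
    (eventually_ge_atTop 2))
  obtain ⟨n₀, hn₀⟩ := eventually_atTop.1 h
  refine ⟨n₀, fun n hn => ?_⟩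
  obtain ⟨a, b, hn2⟩ := hn₀ n hn.le
  have hkn := hk n hn2
  have hs : 0 < √(k n : ℝ) := Real.sqrt_pos.2 (by exact_mod_cast hkn.1)
  rw [Real.dist_eq, sub_zero, abs_of_nonneg (Real.iSup_nonneg fun x => abs_nonneg _)]
  refine (ciSup_le fun x => ?_).trans_lt (by linarith : ε / 2 < ε)
  -- The normalisation is strictly increasing, so evaluating both uniform limits at the image of `x`
  -- gives back the events with threshold `x`.
  have key : ∀ z i, ((n : ℝ) * (z - 1) + k n) / √(k n : ℝ) ≤
      ((n : ℝ) * (x i - 1) + k n) / √(k n : ℝ) ↔ z ≤ x i := fun z i => by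
    have hn' : (0 : ℝ) < n := by positivity
    rw [div_le_div_iff_of_pos_right hs, add_le_add_iff_right, mul_le_mul_iff_right₀ hn',
      sub_le_sub_iff_right]
  have a' := a fun i => ((n : ℝ) * (x i - 1) + k n) / √(k n : ℝ)
  have b' := b fun i => ((n : ℝ) * (x i - 1) + k n) / √(k n : ℝ)
  simp only [key] at a' b'
  rw [dist_comm] at a'
  rw [← Real.dist_eq]
  refine (dist_triangle _ _ _).trans (add_le_add a'.le b'.le) |>.trans (by linarith)
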